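/- Let $V$ be a separable reflexive real Banach space and $H$ a separable real Hilbert space, and let $i:V\to H$ be a linear, continuous, injective and compact map with dense range, so that $V\subset H\subset V^*$ is an evolution triple, $V$ being embedded in $V^*$ by $v\mapsto (i v, i\,\cdot)_H$. Let $0<T<\infty$. Let $A:V\to V^*$ satisfy the following hypotheses $H(A)$: (i) $A$ is pseudomonotone, that is, $A$ is continuous from every finite-dimensional subspace of $V$ into $V^*$ with the weak topology, and whenever $v_n\rightharpoonup v$ weakly in $V$ and $\limsup_{n\to\infty}\langle A v_n, v_n-v\rangle\le 0$, then $\langle A v, v-y\rangle\le\liminf_{n\to\infty}\langle A v_n, v_n-y\rangle$ for every $y\in V$; (ii) there are $a\ge 0$ and $b>0$ with $\|A v\|_{V^*}\le a+b\|v\|_V$ for all $v\in V$; (iii) there are $\alpha>0$ and $\beta\ge 0$ with $\langle A v, v\rangle\ge \alpha\|v\|_V^2-\beta\|i v\|_H^2$ for all $v\in V$. For a function $x:[0,T]\to V^*$ put $$\|x\|_{BV^2(0,T;V^*)}^2=\sup\Big\{\sum_{j=0}^{k-1}\|x(t_{j+1})-x(t_j)\|_{V^*}^2 : 0=t_0<t_1<\dots<t_k=T\Big\};$$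 for a class $u\in L^2(0,T;V)$ let $\|u\|_{BV^2(0,T;V^*)}$ be the infimum of these values over all functions $x:[0,T]\to V^*$ that agree with $u$ almost everywhere. Let $M^{2,2}(0,T;V,V^*)$ be the space of all $u\in L^2(0,T;V)$ with $\|u\|_{BV^2(0,T;V^*)}<\infty$, normed by $\|u\|_{L^2(0,T;V)}+\|u\|_{BV^2(0,T;V^*)}$. Then the Nemytskii operator $\mathcal A:L^2(0,T;V)\to L^2(0,T;V^*)$, $(\mathcal A u)(t)=A(u(t))$ for a.e. $t\in(0,T)$, is well defined and has the following property. If $(u_n)$ is a sequence bounded in $M^{2,2}(0,T;V,V^*)$ such that $u_n\rightharpoonup u$ weakly in $L^2(0,T;V)$ and $$\limsup_{n\to\infty}\int_0^T\langle (\mathcal A u_n)(t), u_n(t)-u(t)\rangle_{V^*\times V}\,dt\le 0,$$ then $\mathcal A u_n\rightharpoonup\mathcal A u$ weakly in $L^2(0,T;V^*)$. -/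

import Mathlib

open MeasureTheory Filter Topology Set
open scoped ENNReal NNReal

noncomputable section

/-- Weak convergence `xₙ ⇀ x` in a real normed space (convergence in the weak topology
`σ(X, X*)`). -/
def WeaklyConverges {X : Type*} [NormedAddCommGroup X] [NormedSpace ℝ X]
    (x : ℕ → X) (a : X) : Prop :=
  Tendsto (fun n => toWeakSpace ℝ X (x n)) atTop (𝓝 (toWeakSpace ℝ X a))

/-- A multifunction `A : X → 2^{X*}` is pseudomonotone. Upper and lower limits of real sequences
are taken in the extended reals. -/
structure IsPseudomonotone {X : Type*} [NormedAddCommGroup X] [NormedSpace ℝ X]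
    (A : X → Set (StrongDual ℝ X)) : Prop where
  nonempty : ∀ v, (A v).Nonempty
  convex : ∀ v, Convex ℝ (A v)
  weaklyCompact : ∀ v, IsCompact (toWeakSpace ℝ (StrongDual ℝ X) '' A v)
  /-- `A` is upper semicontinuous from every finite dimensional subspace of `X` into `X*` with its
  weak topology. -/
  usc : ∀ F : Submodule ℝ X, FiniteDimensional ℝ F →
    UpperHemicontinuousOn (fun v => toWeakSpace ℝ (StrongDual ℝ X) '' A v) (F : Set X)
  liminf_le : ∀ (v : ℕ → X) (w : X) (ξ : ℕ → StrongDual ℝ X),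
    WeaklyConverges v w → (∀ n, ξ n ∈ A (v n)) →
    limsup (fun n => ((ξ n (v n - w) : ℝ) : EReal)) atTop ≤ 0 →
    ∀ y : X, ∃ η ∈ A w,
      ((η (w - y) : ℝ) : EReal) ≤ liminf (fun n => ((ξ n (v n - y) : ℝ) : EReal)) atTop

section Triple

variable {V H : Type*} [NormedAddCommGroup V] [NormedSpace ℝ V]
  [NormedAddCommGroup H] [InnerProductSpace ℝ H]

/-- `i : V → H` is the embedding of an evolution triple `V ⊂ H ⊂ V*`: `V` is reflexive and `i` is
continuous (by its type), injective, dense and compact. -/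
structure IsEvolutionTriple (i : V →L[ℝ] H) : Prop where
  reflexive : Function.Surjective (NormedSpace.inclusionInDoubleDual ℝ V)
  injective : Function.Injective i
  denseRange : DenseRange i
  compact : IsCompactOperator i

/-- The embedding `V ⊂ V*` of an evolution triple, `v ↦ (i v, i ·)_H`. -/
def tripleEmbedding (i : V →L[ℝ] H) : V →L[ℝ] StrongDual ℝ V :=
  (innerSL ℝ (E := H) : H →L[ℝ] H →L[ℝ] ℝ).bilinearComp i i

theorem tripleEmbedding_apply (i : V →L[ℝ] H) (v w : V) :
    tripleEmbedding i v w = inner ℝ (i v) (i w) := rfl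

/-- The assumptions `H(A)`: pseudomonotonicity, linear growth, coercivity. -/
structure HypA (i : V →L[ℝ] H) (A : V → StrongDual ℝ V) : Prop where
  pseudomonotone : IsPseudomonotone fun v => ({A v} : Set (StrongDual ℝ V))
  growth : ∃ a b : ℝ, 0 ≤ a ∧ 0 < b ∧ ∀ v, ‖A v‖ ≤ a + b * ‖v‖
  coercive : ∃ α β : ℝ, 0 < α ∧ 0 ≤ β ∧ ∀ v, α * ‖v‖ ^ 2 - β * ‖i v‖ ^ 2 ≤ A v v

end Triple

/-- Lebesgue measure on the interval `(0,T)`. -/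
abbrev timeMeasure (T : ℝ) : Measure ℝ := volume.restrict (Ioo 0 T)

/-- The Bochner space `L^p(0,T;X)`. -/
abbrev BochnerLp (p : ℝ≥0∞) (T : ℝ) (X : Type*) [NormedAddCommGroup X] : Type _ :=
  Lp X p (timeMeasure T)

/-- The `q`-th power of the `BV^q(0,T;Z)` seminorm of an everywhere defined function: the supremum
of `∑ ‖x(b_i) - x(a_i)‖^q` over all finite partitions `0 = t₀ < t₁ < ⋯ < t_k = T`, with
`a_i = t_i` and `b_i = t_{i+1}`. -/
def qVariation {Z : Type*} [NormedAddCommGroup Z] (q T : ℝ) (x : ℝ → Z) : ℝ≥0∞ :=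
  ⨆ (k : ℕ) (t : ℕ → ℝ) (_ : t 0 = 0) (_ : t k = T) (_ : ∀ j < k, t j < t (j + 1)),
    ∑ j ∈ Finset.range k, ‖x (t (j + 1)) - x (t j)‖ₑ ^ q

section BV

variable {X Z : Type*} [NormedAddCommGroup X] [NormedSpace ℝ X]
  [NormedAddCommGroup Z] [NormedSpace ℝ Z]

/-- The `BV^q(0,T;Z)` seminorm of a class `u ∈ L^p(0,T;X)`, where `X ⊂ Z` through `e`: the infimum
of the seminorms of its everywhere defined `Z`-valued representatives. -/
def bvSeminorm (e : X →L[ℝ] Z) {p : ℝ≥0∞} (q : ℝ) {T : ℝ} (u : BochnerLp p T X) : ℝ≥0∞ :=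
  (⨅ (x : ℝ → Z) (_ : x =ᵐ[timeMeasure T] fun t => e (u t)), qVariation q T x) ^ (1 / q)

/-- The space `M^{p,q}(0,T;X,Z) = L^p(0,T;X) ∩ BV^q(0,T;Z)`, where `X ⊂ Z` through `e`. -/
def MSpace (e : X →L[ℝ] Z) (p : ℝ≥0∞) (q T : ℝ) : Set (BochnerLp p T X) :=
  {u | bvSeminorm e q u < ∞}

/-- The norm `‖u‖_{L^p(0,T;X)} + ‖u‖_{BV^q(0,T;Z)}` of `M^{p,q}(0,T;X,Z)`. -/
def mNorm (e : X →L[ℝ] Z) {p : ℝ≥0∞} (q : ℝ) {T : ℝ} (u : BochnerLp p T X) : ℝ≥0∞ :=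
  ‖u‖ₑ + bvSeminorm e q u

end BV

section Nemytskii

variable {V : Type*} [NormedAddCommGroup V] [NormedSpace ℝ V]

/-- `𝒜 : L²(0,T;V) → L²(0,T;V*)` is the Nemytskii operator of `A`: for every `u`,
`(𝒜 u)(t) = A (u t)` for almost every `t ∈ (0,T)`. (There is at most one such `𝒜`.) -/
def IsNemytskii {T : ℝ} (A : V → StrongDual ℝ V)
    (N : BochnerLp 2 T V → BochnerLp 2 T (StrongDual ℝ V)) : Prop :=
  ∀ u : BochnerLp 2 T V, N u =ᵐ[timeMeasure T] fun t => A (u t)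

/-- The duality pairing `⟨ξ, v⟩ = ∫₀ᵀ ⟨ξ(t), v(t)⟩ dt` of `L²(0,T;V*)` and `L²(0,T;V)`; the
integrand is integrable by Hölder's inequality. -/
def pairing {T : ℝ} (ξ : BochnerLp 2 T (StrongDual ℝ V)) (v : BochnerLp 2 T V) : ℝ :=
  ∫ t, ξ t (v t) ∂timeMeasure T

end Nemytskii

end

/-! ### Weak convergence and separability of duals -/

noncomputable section

/-! The proof turns the integral hypothesis into a pointwise one, applies pseudomonotonicity of `A`
at almost every time, and returns to L² by a Vitali argument. Everything is done along subsequences,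
which suffices because the limit is always the same.

Strong convergence in L²(0,T;H) comes from the variation bound
(`tendsto_compLpL_of_weaklyConverges`). Replacing a function by its means over intervals of length δ
costs O(√δ) in L²(0,T;V*), uniformly in n, because a mean stays within the oscillation on its
interval and the squared oscillations sum to at most the quadratic variation. For fixed δ the means
converge strongly in V*, since V → V* factors through the compact `i`. So the sequence is Cauchy in
L²(0,T;V*), and the estimate ‖w‖² in L²(H) ≤ c ‖w‖ in L²(V*) · ‖w‖ in L²(V) lifts this to H.

Now let i uₙ(t) → i u(t) for almost every t. By coercivity, ηₙ = ⟨A uₙ, uₙ - u⟩ + β‖i(uₙ - u)‖² is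
at least α‖uₙ‖² - g with g integrable. Pointwise, liminf ηₙ ≥ 0 (`HypA.eventually_neg_le`), so
dominated convergence kills the negative parts. Since the integrals have nonpositive limsup, the
positive parts also vanish in L¹, hence almost everywhere along a subsequence. There uₙ(t) is
bounded in V, so it converges weakly, and pseudomonotonicity yields A uₙ(t) ⇀ A u(t).

To pass from weak convergence at almost every t to weak convergence in L²(0,T;V*), functionals on
L²(μ;X) are represented by L²(μ;X*) (`exists_lp_dual_representation`). Riesz gives a scalar density
for each x; a measurable choice of maximising x bounds all densities by one L² function; off a null
set they extend from a countable dense subgroup to elements of X*. -/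

theorem weaklyConverges_iff {X : Type*} [NormedAddCommGroup X] [NormedSpace ℝ X]
    {x : ℕ → X} {a : X} :
    WeaklyConverges x a ↔ ∀ φ : StrongDual ℝ X, Tendsto (fun n => φ (x n)) atTop (𝓝 (φ a)) := by
  refine ⟨fun h φ => ?_, fun h => ?_⟩
  · exact ((WeakBilin.eval_continuous (topDualPairing ℝ X).flip φ).tendsto _).comp h
  · refine (WeakBilin.tendsto_iff_forall_eval_tendsto _ ?_).2 h
    intro u v huv
    refine (SeparatingDual.eq_iff_forall_dual_eq (R := ℝ)).2 fun g => ?_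
    exact DFunLike.congr_fun huv g

theorem WeaklyConverges.comp_tendsto {X : Type*} [NormedAddCommGroup X] [NormedSpace ℝ X]
    {x : ℕ → X} {a : X} (h : WeaklyConverges x a) {φ : ℕ → ℕ} (hφ : Tendsto φ atTop atTop) :
    WeaklyConverges (fun n => x (φ n)) a :=
  Tendsto.comp (f := φ) h hφ

theorem WeaklyConverges.map {X Y : Type*} [NormedAddCommGroup X] [NormedSpace ℝ X]
    [NormedAddCommGroup Y] [NormedSpace ℝ Y] {x : ℕ → X} {a : X} (h : WeaklyConverges x a)
    (L : X →L[ℝ] Y) : WeaklyConverges (fun n => L (x n)) (L a) :=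
  weaklyConverges_iff.2 fun φ => weaklyConverges_iff.1 h (φ.comp L)

theorem WeaklyConverges.unique {X : Type*} [NormedAddCommGroup X] [NormedSpace ℝ X]
    {x : ℕ → X} {a b : X} (ha : WeaklyConverges x a) (hb : WeaklyConverges x b) : a = b :=
  (SeparatingDual.eq_iff_forall_dual_eq (R := ℝ)).2 fun φ =>
    tendsto_nhds_unique (weaklyConverges_iff.1 ha φ) (weaklyConverges_iff.1 hb φ)

theorem weaklyConverges_of_tendsto {X : Type*} [NormedAddCommGroup X] [NormedSpace ℝ X]
    {x : ℕ → X} {a : X} (h : Tendsto x atTop (𝓝 a)) : WeaklyConverges x a :=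
  weaklyConverges_iff.2 fun φ => (φ.continuous.tendsto a).comp h

/-- A normed space with separable dual is separable. -/
theorem separableSpace_of_dual {X : Type*} [NormedAddCommGroup X] [NormedSpace ℝ X]
    [TopologicalSpace.SeparableSpace (StrongDual ℝ X)] : TopologicalSpace.SeparableSpace X := by
  let f := TopologicalSpace.denseSeq (StrongDual ℝ X)
  -- Vectors that nearly norm a dense set of functionals span a dense subspace: a functional
  -- vanishing on all of them is far from every `f n`.
  have hx : ∀ n, ∃ x : X, ‖x‖ ≤ 1 ∧ ‖f n‖ / 2 ≤ ‖f n x‖ := by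
    intro n
    by_contra! h
    have h1 : ‖f n‖ ≤ ‖f n‖ / 2 := by
      refine ContinuousLinearMap.opNorm_le_of_unit_norm (by positivity) fun x hx => ?_
      exact (h x hx.le).le
    have h2 : ‖f n‖ = 0 := le_antisymm (by linarith) (norm_nonneg _)
    have := h 0 (by simp)
    simp [h2] at this
  choose x hx1 hx2 using hx
  have hsep : TopologicalSpace.IsSeparable
      (((Submodule.span ℝ (range x)).topologicalClosure : Submodule ℝ X) : Set X) :=
    (countable_range x).isSeparable.span.closure
  have htop : (Submodule.span ℝ (range x)).topologicalClosure = ⊤ := by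
    by_contra hne
    obtain ⟨y, hy⟩ : ∃ y, y ∉ (Submodule.span ℝ (range x)).topologicalClosure := by
      by_contra! h
      exact hne (Submodule.eq_top_iff'.2 h)
    obtain ⟨g, c, hg1, hg2⟩ := geometric_hahn_banach_closed_point
      (Submodule.convex (Submodule.span ℝ (range x)).topologicalClosure)
      (Submodule.isClosed_topologicalClosure _) hy
    have hg0 : ∀ z ∈ Submodule.span ℝ (range x), g z = 0 := by
      intro z hz
      by_contra hgz
      -- A functional bounded above by `c` on a subspace vanishes there: this multiple of `z` has
      -- value `c + 1`.
      have := hg1 (((c + 1) / g z) • z)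
        (Submodule.smul_mem _ _ (Submodule.le_topologicalClosure _ hz))
      rw [map_smul, smul_eq_mul, div_mul_cancel₀ _ hgz] at this
      linarith
    have hgy : g ≠ 0 := by
      rintro rfl
      have := hg1 0 (Submodule.zero_mem _)
      simp at this hg2
      linarith
    have hpos : 0 < ‖g‖ := norm_pos_iff.2 hgy
    obtain ⟨n, hn⟩ := Metric.denseRange_iff.1 (TopologicalSpace.denseRange_denseSeq
      (StrongDual ℝ X)) g (‖g‖ / 4) (by positivity)
    rw [dist_eq_norm] at hn
    have e1 : ‖f n (x n)‖ ≤ ‖g - f n‖ := by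
      have h0 : g (x n) = 0 := hg0 _ (Submodule.subset_span ⟨n, rfl⟩)
      calc ‖f n (x n)‖ = ‖(g - f n) (x n)‖ := by simp [h0]
        _ ≤ ‖g - f n‖ * ‖x n‖ := (g - f n).le_opNorm _
        _ ≤ ‖g - f n‖ * 1 := by gcongr; exact hx1 n
        _ = _ := mul_one _
    have e2 : ‖g‖ ≤ ‖g - f n‖ + ‖f n‖ := by simpa using norm_add_le (g - f n) (f n)
    have := hx2 n
    have hn' : ‖g - f n‖ < ‖g‖ / 4 := hn
    linarith
  rw [htop] at hsep
  exact TopologicalSpace.isSeparable_univ_iff.1 (by simpa using hsep)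

/-- The dual of a separable reflexive space is separable. -/
theorem separableSpace_dual_of_reflexive {V : Type*} [NormedAddCommGroup V] [NormedSpace ℝ V]
    [TopologicalSpace.SeparableSpace V]
    (h : Function.Surjective (NormedSpace.inclusionInDoubleDual ℝ V)) :
    TopologicalSpace.SeparableSpace (StrongDual ℝ V) := by
  have : TopologicalSpace.SeparableSpace (StrongDual ℝ (StrongDual ℝ V)) :=
    h.denseRange.separableSpace (NormedSpace.inclusionInDoubleDual ℝ V).continuous
  exact separableSpace_of_dual

/-! ### Weak convergence in V against strong convergence in H -/

section Triple

variable {V H : Type*} [NormedAddCommGroup V] [NormedSpace ℝ V]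
  [NormedAddCommGroup H] [InnerProductSpace ℝ H]

/-- In a reflexive space, a bounded sequence whose image under an injective operator converges
is weakly convergent. -/
theorem weaklyConverges_of_bounded [CompleteSpace H] {i : V →L[ℝ] H} (hi : IsEvolutionTriple i)
    {v : ℕ → V} {w : V} {C : ℝ} (hv : ∀ n, ‖v n‖ ≤ C)
    (h : Tendsto (fun n => i (v n)) atTop (𝓝 (i w))) : WeaklyConverges v w := by
  rw [weaklyConverges_iff]
  let S : Submodule ℝ (StrongDual ℝ V) :=
    LinearMap.range (((innerSL ℝ (E := H)).flip.bilinearComp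
      (ContinuousLinearMap.id ℝ H) i).toLinearMap)
  -- The functionals (k, i ·) are dense in V*: by reflexivity an annihilator is some z in V with i z
  -- orthogonal to H, so z = 0 by injectivity. On a bounded sequence, testing with a dense set is
  -- enough.
  have hS : S.topologicalClosure = ⊤ := by
    by_contra hne
    obtain ⟨y, hy⟩ : ∃ y, y ∉ S.topologicalClosure := by
      by_contra! h
      exact hne (Submodule.eq_top_iff'.2 h)
    obtain ⟨g, c, hg1, hg2⟩ := geometric_hahn_banach_closed_point
      (Submodule.convex S.topologicalClosure) (Submodule.isClosed_topologicalClosure _) hy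
    obtain ⟨z, rfl⟩ := hi.reflexive g
    have hg0 : ∀ k : H, inner ℝ (i z) k = 0 := by
      intro k
      by_contra hgz
      have := hg1 _ (Submodule.le_topologicalClosure S
        (LinearMap.mem_range_self _ (((c + 1) / inner ℝ (i z) k) • k)))
      simp only [NormedSpace.dual_def, ContinuousLinearMap.coe_coe,
        ContinuousLinearMap.bilinearComp_apply, ContinuousLinearMap.flip_apply,
        ContinuousLinearMap.id_apply, innerSL_apply_apply, inner_smul_right] at this
      rw [div_mul_cancel₀ _ hgz] at this
      linarith
    have hz : z = 0 := hi.injective (by rw [map_zero]; exact inner_self_eq_zero.1 (hg0 (i z)))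
    have := hg1 0 (Submodule.zero_mem _)
    simp [hz] at this hg2
    linarith
  intro φ
  have hC : 0 ≤ C := (norm_nonneg _).trans (hv 0)
  rw [Metric.tendsto_atTop]
  intro ε hε
  have hφ : φ ∈ closure (S : Set (StrongDual ℝ V)) := by
    rw [← Submodule.topologicalClosure_coe, hS]; trivial
  obtain ⟨ψ, hψ, hd⟩ := Metric.mem_closure_iff.1 hφ (ε / (2 * (C + ‖w‖ + 1))) (by positivity)
  obtain ⟨k, rfl⟩ := hψ
  rw [dist_eq_norm] at hd
  set ψ : StrongDual ℝ V := (((innerSL ℝ (E := H)).flip.bilinearComp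
      (ContinuousLinearMap.id ℝ H) i).toLinearMap) k with hψ
  have hk : Tendsto (fun n => ψ (v n)) atTop (𝓝 (ψ w)) :=
    h.inner tendsto_const_nhds
  obtain ⟨N, hN⟩ := Metric.tendsto_atTop.1 hk (ε / 2) (by positivity)
  refine ⟨N, fun n hn => ?_⟩
  have h1 := hN n hn
  rw [dist_eq_norm] at h1 ⊢
  have h2 : ‖(φ - ψ) (v n - w)‖ ≤ ‖φ - ψ‖ * (C + ‖w‖) :=
    ((φ - ψ).le_opNorm _).trans (by gcongr; exact (norm_sub_le _ _).trans (by gcongr; exact hv n))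
  have h3 : ‖φ - ψ‖ * (C + ‖w‖) ≤ ε / 2 := by
    rw [lt_div_iff₀ (by positivity)] at hd
    have := norm_nonneg (φ - ψ)
    nlinarith
  have h4 : φ (v n) - φ w = (φ - ψ) (v n - w) + (ψ (v n) - ψ w) := by
    simp only [sub_apply, map_sub]; ring
  rw [h4]
  refine (norm_add_le _ _).trans_lt ?_
  linarith

/-- A compact operator maps bounded weakly convergent sequences to convergent ones. -/
theorem IsCompactOperator.tendsto_of_weaklyConverges {i : V →L[ℝ] H} (hi : IsCompactOperator i)
    {v : ℕ → V} {w : V} {C : ℝ} (hv : ∀ n, ‖v n‖ ≤ C) (h : WeaklyConverges v w) :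
    Tendsto (fun n => i (v n)) atTop (𝓝 (i w)) := by
  refine tendsto_of_subseq_tendsto fun ns hns => ?_
  have hK := hi.isCompact_closure_image_closedBall (f := (i : V →ₗ[ℝ] H)) C
  obtain ⟨a, -, φ, hφ, ha⟩ := hK.tendsto_subseq (x := fun n => i (v (ns n))) fun n =>
    subset_closure ⟨v (ns n), by simpa using hv _, rfl⟩
  refine ⟨φ, ?_⟩
  have := (weaklyConverges_of_tendsto ha).unique
    (((h.comp_tendsto hns).map i).comp_tendsto hφ.tendsto_atTop)
  rwa [this] at ha

end Triple

/-! ### Pointwise consequences of pseudomonotonicity and coercivity -/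

theorem eventually_lt_of_limsup_coe_le {x : ℕ → ℝ} {a b : ℝ}
    (h : limsup (fun n => ((x n : ℝ) : EReal)) atTop ≤ a) (hab : a < b) :
    ∀ᶠ n in atTop, x n < b := by
  have := eventually_lt_of_limsup_lt (h.trans_lt (EReal.coe_lt_coe_iff.2 hab))
  filter_upwards [this] with n hn using EReal.coe_lt_coe_iff.1 hn

theorem eventually_lt_of_le_liminf_coe {x : ℕ → ℝ} {a b : ℝ}
    (h : (a : EReal) ≤ liminf (fun n => ((x n : ℝ) : EReal)) atTop) (hab : b < a) :
    ∀ᶠ n in atTop, b < x n := by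
  have := eventually_lt_of_lt_liminf ((EReal.coe_lt_coe_iff.2 hab).trans_le h)
  filter_upwards [this] with n hn using EReal.coe_lt_coe_iff.1 hn

theorem limsup_coe_le_of_eventually {x : ℕ → ℝ} {a : ℝ} (h : ∀ b > a, ∀ᶠ n in atTop, x n ≤ b) :
    limsup (fun n => ((x n : ℝ) : EReal)) atTop ≤ a := by
  refine EReal.le_of_forall_lt_iff_le.1 fun z hz => ?_
  refine limsup_le_of_le (by isBoundedDefault) ?_
  filter_upwards [h z (EReal.coe_lt_coe_iff.1 hz)] with n hn using EReal.coe_le_coe_iff.2 hn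

section Pseudomonotone

variable {V : Type*} [NormedAddCommGroup V] [NormedSpace ℝ V]

theorem IsPseudomonotone.le_liminf {A : V → StrongDual ℝ V}
    (hA : IsPseudomonotone fun v => ({A v} : Set (StrongDual ℝ V))) {v : ℕ → V} {w : V}
    (hv : WeaklyConverges v w) (h : ∀ ε > 0, ∀ᶠ n in atTop, A (v n) (v n - w) ≤ ε) (y : V) :
    ((A w (w - y) : ℝ) : EReal) ≤ liminf (fun n => ((A (v n) (v n - y) : ℝ) : EReal)) atTop := by
  obtain ⟨η, rfl, hη⟩ := hA.liminf_le v w (fun n => A (v n)) hv (fun n => rfl)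
    (limsup_coe_le_of_eventually (a := 0) h) y
  exact hη

/-- Testing the lower limit inequality at y = w - z bounds ⟨A vₙ, z⟩ from below in the limit,
because ⟨A vₙ, vₙ - w⟩ is asymptotically nonpositive. Using -z as well gives the upper bound. -/
theorem IsPseudomonotone.tendsto_apply {A : V → StrongDual ℝ V}
    (hA : IsPseudomonotone fun v => ({A v} : Set (StrongDual ℝ V))) {v : ℕ → V} {w : V}
    (hv : WeaklyConverges v w) (h : ∀ ε > 0, ∀ᶠ n in atTop, A (v n) (v n - w) ≤ ε) (z : V) :
    Tendsto (fun n => A (v n) z) atTop (𝓝 (A w z)) := by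
  have key : ∀ z, ∀ ε > 0, ∀ᶠ n in atTop, A w z - ε < A (v n) z := by
    intro z ε hε
    have h1 := eventually_lt_of_le_liminf_coe (hA.le_liminf hv h (w - z))
      (b := A w z - ε / 2) (by simp [hε])
    filter_upwards [h1, h (ε / 2) (by positivity)] with n hn hn'
    have : v n - (w - z) = (v n - w) + z := by abel
    rw [this, map_add] at hn
    linarith
  rw [Metric.tendsto_nhds]
  intro ε hε
  filter_upwards [key z ε hε, key (-z) ε hε] with n h1 h2
  rw [Real.dist_eq, abs_lt]
  simp only [map_neg] at h2
  constructor <;> linarith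

variable {H : Type*} [NormedAddCommGroup H] [InnerProductSpace ℝ H]

/-- A bounded operator satisfying `H(A)` is demicontinuous. -/
theorem HypA.continuous_apply {i : V →L[ℝ] H} {A : V → StrongDual ℝ V} (hA : HypA i A) (z : V) :
    Continuous fun v => A v z := by
  rw [continuous_iff_seqContinuous]
  intro v w hv
  refine hA.pseudomonotone.tendsto_apply (weaklyConverges_of_tendsto hv) (fun ε hε => ?_) z
  obtain ⟨a, b, ha, hb, hab⟩ := hA.growth
  have h0 : Tendsto (fun n => (a + b * ‖v n‖) * ‖v n - w‖) atTop (𝓝 0) := by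
    have h1 : Tendsto (fun n => ‖v n - w‖) atTop (𝓝 0) := tendsto_iff_norm_sub_tendsto_zero.1 hv
    simpa using (tendsto_const_nhds.add (tendsto_const_nhds.mul hv.norm)).mul h1
  filter_upwards [h0.eventually_lt_const hε] with n hn
  refine ((le_abs_self _).trans ((A (v n)).le_opNorm _)).trans (le_trans ?_ hn.le)
  gcongr
  exact hab _

/-- The coercivity estimate behind the a priori bounds. -/
theorem HypA.exists_lower_bound {i : V →L[ℝ] H} {A : V → StrongDual ℝ V} (hA : HypA i A) :
    ∃ α β c : ℝ, 0 < α ∧ 0 ≤ β ∧ 0 ≤ c ∧ ∀ v w : V,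
      α * ‖v‖ ^ 2 - c * (1 + ‖w‖ ^ 2) - β * ‖i (v - w)‖ ^ 2 ≤ A v (v - w) := by
  obtain ⟨a, b, ha, hb, hab⟩ := hA.growth
  obtain ⟨α, β, hα, hβ, hαβ⟩ := hA.coercive
  -- Half of α absorbs the cross term b‖v‖‖w‖ by Young's inequality; the factor 2 on β comes from
  -- splitting i v = i(v - w) + i w.
  refine ⟨α / 2, 2 * β, 2 * β * ‖i‖ ^ 2 + a + b ^ 2 / (2 * α), by positivity, by positivity,
    by positivity, fun v w => ?_⟩
  have h1 : A v w ≤ (a + b * ‖v‖) * ‖w‖ :=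
    ((le_abs_self _).trans ((A v).le_opNorm _)).trans (by gcongr; exact hab v)
  have h2 : ‖i v‖ ^ 2 ≤ 2 * ‖i (v - w)‖ ^ 2 + 2 * (‖i‖ ^ 2 * ‖w‖ ^ 2) := by
    have e1 : ‖i v‖ ≤ ‖i (v - w)‖ + ‖i‖ * ‖w‖ := by
      have : i v = i (v - w) + i w := by simp
      rw [this]
      exact (norm_add_le _ _).trans (by gcongr; exact i.le_opNorm w)
    have e2 : ‖i v‖ ^ 2 ≤ (‖i (v - w)‖ + ‖i‖ * ‖w‖) ^ 2 := by gcongr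
    nlinarith [sq_nonneg (‖i (v - w)‖ - ‖i‖ * ‖w‖)]
  have h3 := hαβ v
  have h4 : b * ‖v‖ * ‖w‖ ≤ α / 2 * ‖v‖ ^ 2 + b ^ 2 / (2 * α) * ‖w‖ ^ 2 := by
    have : α / 2 * ‖v‖ ^ 2 + b ^ 2 / (2 * α) * ‖w‖ ^ 2 - b * ‖v‖ * ‖w‖
        = (α * ‖v‖ - b * ‖w‖) ^ 2 / (2 * α) := by field_simp; ring
    have : 0 ≤ (α * ‖v‖ - b * ‖w‖) ^ 2 / (2 * α) := by positivity
    linarith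
  have h5 : a * ‖w‖ ≤ a * (1 + ‖w‖ ^ 2) := by
    gcongr; nlinarith [sq_nonneg (‖w‖ - 1)]
  have h6 : 0 ≤ b ^ 2 / (2 * α) := by positivity
  have h7 : 0 ≤ β * ‖i‖ ^ 2 := by positivity
  rw [map_sub (A v)]
  have h8 := mul_le_mul_of_nonneg_left h2 hβ
  linarith

/-- A lower bound for the duality products along a sequence converging in `H`. -/
theorem HypA.eventually_neg_le [CompleteSpace H] {i : V →L[ℝ] H} (hi : IsEvolutionTriple i)
    {A : V → StrongDual ℝ V} (hA : HypA i A) {v : ℕ → V} {w : V}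
    (h : Tendsto (fun n => i (v n)) atTop (𝓝 (i w))) {ε : ℝ} (hε : 0 < ε) :
    ∀ᶠ n in atTop, -ε ≤ A (v n) (v n - w) := by
  by_contra hcon
  rw [not_eventually] at hcon
  obtain ⟨α, β, c, hα, hβ, hc, hlow⟩ := hA.exists_lower_bound
  have hb : ∀ᶠ n in atTop, ‖i (v n - w)‖ < 1 := by
    have : Tendsto (fun n => ‖i (v n - w)‖) atTop (𝓝 0) := by
      simpa only [map_sub] using tendsto_iff_norm_sub_tendsto_zero.1 h
    exact this.eventually_lt_const one_pos
  -- Along a subsequence with products below -ε, coercivity bounds the sequence in V, so it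
  -- converges weakly. The limsup condition is then automatic, and pseudomonotonicity at y = w
  -- forces a nonnegative lower limit, a contradiction.
  obtain ⟨φ, hφ, hP⟩ := extraction_of_frequently_atTop (hcon.and_eventually hb)
  have hbd : ∀ n, ‖v (φ n)‖ ≤ (c * (1 + ‖w‖ ^ 2) + β) / α + 1 := by
    intro n
    obtain ⟨h1, h2⟩ := hP n
    push Not at h1
    have h3 := hlow (v (φ n)) w
    have h4 : ‖i (v (φ n) - w)‖ ^ 2 ≤ 1 := pow_le_one₀ (norm_nonneg _) h2.le
    have h5 : ‖v (φ n)‖ ^ 2 ≤ (c * (1 + ‖w‖ ^ 2) + β) / α := by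
      rw [le_div_iff₀ hα]
      nlinarith
    nlinarith [sq_nonneg (‖v (φ n)‖ - 1)]
  have hw := weaklyConverges_of_bounded hi hbd (h.comp hφ.tendsto_atTop)
  have h1 := hA.pseudomonotone.le_liminf hw (fun δ hδ => Eventually.of_forall fun n => by
    have := (hP n).1
    push Not at this
    linarith) w
  have h2 := eventually_lt_of_le_liminf_coe (b := -ε) h1 (by simpa using hε)
  obtain ⟨n, hn⟩ := h2.exists
  exact (hP n).1 hn.le

end Pseudomonotone

/-! ### Measurability and the Nemytskii operator -/

/-- A function into a separable dual space is measurable as soon as its evaluations on a countable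
dense set are. -/
theorem measurable_of_measurable_apply {Ω X : Type*} [MeasurableSpace Ω] [NormedAddCommGroup X]
    [NormedSpace ℝ X] [TopologicalSpace.SeparableSpace (StrongDual ℝ X)]
    [MeasurableSpace (StrongDual ℝ X)] [BorelSpace (StrongDual ℝ X)]
    {G : Ω → StrongDual ℝ X} {D : Set X} (hDc : D.Countable) (hD : Dense D)
    (hG : ∀ x ∈ D, Measurable fun t => G t x) : Measurable G := by
  have : SecondCountableTopology (StrongDual ℝ X) := UniformSpace.secondCountable_of_separable _
  have hball : ∀ (c : StrongDual ℝ X) (r : ℝ), 0 ≤ r →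
      MeasurableSet (G ⁻¹' Metric.closedBall c r) := by
    intro c r hr
    -- The dual norm is tested on the countable dense set alone, so membership in a closed ball is a
    -- countable family of scalar conditions.
    have : G ⁻¹' Metric.closedBall c r = ⋂ x ∈ D, {t | ‖G t x - c x‖ ≤ r * ‖x‖} := by
      ext t
      simp only [mem_preimage, mem_closedBall_iff_norm, mem_iInter, mem_ofPred_eq]
      refine ⟨fun h x _ => ((G t - c).le_opNorm x).trans (by gcongr), fun h => ?_⟩
      refine ContinuousLinearMap.opNorm_le_bound _ hr fun x => ?_
      have hcl : IsClosed {x : X | ‖(G t - c) x‖ ≤ r * ‖x‖} :=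
        isClosed_le (by fun_prop) (by fun_prop)
      exact (hcl.closure_subset_iff.2 (fun x hx => h x hx)) (hD x)
    rw [this]
    exact MeasurableSet.biInter hDc fun x hx =>
      measurableSet_le ((hG x hx).sub_const _).norm measurable_const
  refine measurable_of_isOpen fun U hU => ?_
  let Q : Set (StrongDual ℝ X × ℕ) := {q : StrongDual ℝ X × ℕ |
    q.1 ∈ range (TopologicalSpace.denseSeq (StrongDual ℝ X)) ∧
      Metric.closedBall q.1 (1 / ((q.2 : ℝ) + 1)) ⊆ U}
  have hQ : Q.Countable :=
    ((countable_range (TopologicalSpace.denseSeq (StrongDual ℝ X))).prod countable_univ).mono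
      fun q hq => mem_prod.2 ⟨hq.1, mem_univ _⟩
  have hUQ : U = ⋃ q ∈ Q, Metric.closedBall q.1 (1 / ((q.2 : ℝ) + 1)) := by
    refine Subset.antisymm (fun f hf => ?_) (iUnion₂_subset fun q hq => hq.2)
    obtain ⟨ε, hε, hU'⟩ := Metric.isOpen_iff.1 hU f hf
    obtain ⟨n, hn⟩ := exists_nat_one_div_lt (half_pos hε)
    obtain ⟨m, hm⟩ := Metric.denseRange_iff.1 (TopologicalSpace.denseRange_denseSeq
      (StrongDual ℝ X)) f (1 / ((n : ℝ) + 1)) (by positivity)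
    refine mem_iUnion₂.2 ⟨(TopologicalSpace.denseSeq _ m, n), ⟨⟨m, rfl⟩, fun g hg => hU' ?_⟩,
      hm.le⟩
    have hg' : dist g (TopologicalSpace.denseSeq (StrongDual ℝ X) m) ≤ 1 / ((n : ℝ) + 1) := hg
    rw [Metric.mem_ball]
    linarith [dist_triangle_right g f (TopologicalSpace.denseSeq (StrongDual ℝ X) m)]
  rw [hUQ, preimage_iUnion₂]
  exact MeasurableSet.biUnion hQ fun q _ => hball _ _ (by positivity)

section Nemytskii

variable {V H : Type*} [NormedAddCommGroup V] [NormedSpace ℝ V]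
  [NormedAddCommGroup H] [InnerProductSpace ℝ H]

/-- An operator satisfying `H(A)` is Borel measurable. -/
theorem HypA.measurable [TopologicalSpace.SeparableSpace V] [MeasurableSpace V] [BorelSpace V]
    [MeasurableSpace (StrongDual ℝ V)] [BorelSpace (StrongDual ℝ V)]
    {i : V →L[ℝ] H} (hi : IsEvolutionTriple i) {A : V → StrongDual ℝ V} (hA : HypA i A) :
    Measurable A := by
  have := separableSpace_dual_of_reflexive hi.reflexive
  obtain ⟨D, hDc, hD⟩ := TopologicalSpace.exists_countable_dense V
  exact measurable_of_measurable_apply hDc hD fun x _ => (hA.continuous_apply x).measurable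

theorem HypA.memLp_comp [TopologicalSpace.SeparableSpace V] {i : V →L[ℝ] H}
    (hi : IsEvolutionTriple i) {A : V → StrongDual ℝ V} (hA : HypA i A) {T : ℝ}
    (u : BochnerLp 2 T V) : MemLp (fun t => A (u t)) 2 (timeMeasure T) := by
  have hsep := separableSpace_dual_of_reflexive hi.reflexive
  have : SecondCountableTopology (StrongDual ℝ V) := UniformSpace.secondCountable_of_separable _
  obtain ⟨a, b, ha, hb, hab⟩ := hA.growth
  borelize V (StrongDual ℝ V)
  have hm : AEStronglyMeasurable (fun t => A (u t)) (timeMeasure T) :=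
    ((hA.measurable hi).comp (Lp.stronglyMeasurable u).measurable).aestronglyMeasurable
  have hg : MemLp (fun t => a + b * ‖u t‖) 2 (timeMeasure T) :=
    (memLp_const a).add ((Lp.memLp u).norm.const_mul b)
  refine hg.mono hm (ae_of_all _ fun t => (hab _).trans (le_abs_self _))

/-- The Nemytskii operator of an operator satisfying `H(A)`. -/
def HypA.nemytskii [TopologicalSpace.SeparableSpace V] {i : V →L[ℝ] H}
    (hi : IsEvolutionTriple i) {A : V → StrongDual ℝ V} (hA : HypA i A) {T : ℝ}
    (u : BochnerLp 2 T V) : BochnerLp 2 T (StrongDual ℝ V) :=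
  (hA.memLp_comp hi u).toLp

theorem HypA.isNemytskii [TopologicalSpace.SeparableSpace V] {i : V →L[ℝ] H}
    (hi : IsEvolutionTriple i) {A : V → StrongDual ℝ V} (hA : HypA i A) (T : ℝ) :
    IsNemytskii (T := T) A (hA.nemytskii hi) :=
  fun u => (hA.memLp_comp hi u).coeFn_toLp

end Nemytskii

/-! ### The dual of L²(μ;X) and weak convergence from pointwise weak convergence -/

section LpDual

/-- A measurable choice of an index at which the maximum of finitely many functions is attained. -/
theorem exists_measurable_argmax {Ω : Type*} [MeasurableSpace Ω] {γ : ℕ → Ω → ℝ}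
    (hγ : ∀ j, Measurable (γ j)) :
    ∃ σ : ℕ → Ω → ℕ, (∀ m, Measurable (σ m)) ∧ (∀ m t, σ m t ≤ m) ∧
      ∀ m t, ∀ j ≤ m, γ j t ≤ γ (σ m t) t := by
  have hsel : ∀ σ : Ω → ℕ, Measurable σ → Measurable fun t => γ (σ t) t := fun σ hσ =>
    (measurable_from_prod_countable_right (f := fun p : ℕ × Ω => γ p.1 p.2) hγ).comp
      (hσ.prodMk measurable_id)
  let σ : ℕ → Ω → ℕ := fun m => Nat.rec (fun _ => 0)
    (fun m s t => if γ (s t) t < γ (m + 1) t then m + 1 else s t) m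
  have hσ : ∀ m t, σ (m + 1) t = if γ (σ m t) t < γ (m + 1) t then m + 1 else σ m t :=
    fun m t => rfl
  refine ⟨σ, fun m => ?_, fun m t => ?_, fun m t => ?_⟩
  · induction m with
    | zero => exact measurable_const
    | succ m ih =>
      exact Measurable.ite (measurableSet_lt (hsel _ ih) (hγ _)) measurable_const ih
  · induction m with
    | zero => exact le_rfl
    | succ m ih => rw [hσ]; split_ifs <;> omega
  · induction m with
    | zero => intro j hj; rw [Nat.le_zero.1 hj]; rfl
    | succ m ih =>
      intro j hj
      rw [hσ]
      rcases Nat.of_le_succ hj with hj | rfl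
      · split_ifs with h
        · exact (ih j hj).trans h.le
        · exact ih j hj
      · split_ifs with h
        · exact le_rfl
        · exact not_lt.1 h

/-- A bounded additive function on a dense subgroup extends to a continuous linear functional. -/
theorem exists_dual_extension {X : Type*} [NormedAddCommGroup X] [NormedSpace ℝ X]
    {D : Submodule ℤ X} (hD : Dense (D : Set X)) {f : X → ℝ} {C : ℝ}
    (hadd : ∀ x ∈ D, ∀ y ∈ D, f (x + y) = f x + f y) (hC : ∀ x ∈ D, |f x| ≤ C * ‖x‖) :
    ∃ G : StrongDual ℝ X, ∀ x ∈ D, G x = f x := by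
  let f₀ : D →+ ℝ := AddMonoidHom.mk' (fun x => f x) fun x y => hadd x x.2 y y.2
  -- `D` is only an additive group, so the extension by continuity is made as an additive map;
  -- continuous additive maps of real spaces are ℝ-linear.
  let f₁ : D →L[ℕ] ℝ :=
    { toLinearMap := f₀.toNatLinearMap
      cont := AddMonoidHomClass.continuous_of_bound f₀ C fun x => hC x x.2 }
  let e : D →L[ℕ] X :=
    { toLinearMap := D.subtype.toAddMonoidHom.toNatLinearMap
      cont := continuous_subtype_val }
  have he : DenseRange e := by
    have : range e = (D : Set X) := Subtype.range_coe
    rw [DenseRange, this]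
    exact hD
  have he' : IsUniformInducing e := isUniformEmbedding_subtype_val.isUniformInducing
  refine ⟨AddMonoidHom.toRealLinearMap ((f₁.extend e).toLinearMap.toAddMonoidHom)
    (f₁.extend e).continuous, fun x hx => ?_⟩
  exact f₁.extend_eq he he' ⟨x, hx⟩

variable {Ω X : Type*} [MeasurableSpace Ω] {μ : Measure Ω} [NormedAddCommGroup X] [NormedSpace ℝ X]

/-- The function `t ↦ φ t • x`, bilinear in `x` and `φ`. -/
def smulConstLp (μ : Measure Ω) (X : Type*) [NormedAddCommGroup X] [NormedSpace ℝ X] :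
    X →L[ℝ] Lp ℝ 2 μ →L[ℝ] Lp X 2 μ :=
  ContinuousLinearMap.compLpL₂ 2 μ (ContinuousLinearMap.lsmul ℝ ℝ).flip

theorem coeFn_smulConstLp (x : X) (φ : Lp ℝ 2 μ) :
    smulConstLp μ X x φ =ᵐ[μ] fun t => φ t • x := by
  filter_upwards [ContinuousLinearMap.coeFn_compLp
    ((ContinuousLinearMap.lsmul ℝ ℝ).flip x : ℝ →L[ℝ] X) φ] with t ht
  rw [smulConstLp, ContinuousLinearMap.compLpL₂_apply_apply, ht]
  simp

/-- The square integrable density of the set function `E ↦ Λ (1_E x)`. -/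
def dualDensity (Λ : StrongDual ℝ (Lp X 2 μ)) (x : X) : Lp ℝ 2 μ :=
  (InnerProductSpace.toDual ℝ (Lp ℝ 2 μ)).symm (Λ ∘L smulConstLp μ X x)

theorem inner_dualDensity (Λ : StrongDual ℝ (Lp X 2 μ)) (x : X) (φ : Lp ℝ 2 μ) :
    inner ℝ (dualDensity Λ x) φ = Λ (smulConstLp μ X x φ) := by
  rw [dualDensity, InnerProductSpace.toDual_symm_apply]
  rfl

theorem dualDensity_add (Λ : StrongDual ℝ (Lp X 2 μ)) (x y : X) :
    dualDensity Λ (x + y) = dualDensity Λ x + dualDensity Λ y := by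
  refine ext_inner_right ℝ fun φ => ?_
  simp [inner_add_left, inner_dualDensity]

theorem dualDensity_smul (Λ : StrongDual ℝ (Lp X 2 μ)) (c : ℝ) (x : X) :
    dualDensity Λ (c • x) = c • dualDensity Λ x := by
  refine ext_inner_right ℝ fun φ => ?_
  simp [inner_smul_left, inner_dualDensity]

/-- Duality trick: let φ be the selected density and test Λ on F(t) = φ(t) x_{σ(t)}. Then ΛF = ‖φ‖²
while ‖F‖ ≤ ‖φ‖, so ‖φ‖ ≤ ‖Λ‖. The bound does not depend on `m`, which permits monotone convergence
later. -/
theorem lintegral_dualDensity_select_le (Λ : StrongDual ℝ (Lp X 2 μ)) {x : ℕ → X}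
    (hx : ∀ j, ‖x j‖ ≤ 1) {σ : Ω → ℕ} (hσ : Measurable σ) {m : ℕ} (hσm : ∀ t, σ t ≤ m) :
    ∫⁻ t, ‖dualDensity Λ (x (σ t)) t‖ₑ ^ (2 : ℝ) ∂μ ≤ ‖Λ‖ₑ ^ (2 : ℝ) := by
  have hmeas : ∀ j, MeasurableSet (σ ⁻¹' {j}) := fun j => hσ (measurableSet_singleton j)
  let ψ : ℕ → Lp ℝ 2 μ := fun j => ((Lp.memLp (dualDensity Λ (x j))).indicator (hmeas j)).toLp
  have hψ : ∀ j, ψ j =ᵐ[μ] (σ ⁻¹' {j}).indicator (dualDensity Λ (x j)) := fun j =>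
    MemLp.coeFn_toLp _
  let φ : Lp ℝ 2 μ := ∑ j ∈ Finset.range (m + 1), ψ j
  let F : Lp X 2 μ := ∑ j ∈ Finset.range (m + 1), smulConstLp μ X (x j) (ψ j)
  have hφ : φ =ᵐ[μ] fun t => dualDensity Λ (x (σ t)) t := by
    filter_upwards [ae_all_iff.2 hψ,
      Lp.coeFn_finsetSum (Finset.range (m + 1)) ψ] with t h1 h2
    rw [h2, Finset.sum_apply, Finset.sum_eq_single_of_mem (σ t)
      (Finset.mem_range.2 (Nat.lt_succ_of_le (hσm t)))]
    · rw [h1, indicator_of_mem (show t ∈ σ ⁻¹' {σ t} from rfl)]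
    · intro j _ hj
      rw [h1, indicator_of_notMem]
      exact fun h => hj h.symm
  have hF : F =ᵐ[μ] fun t => φ t • x (σ t) := by
    filter_upwards [ae_all_iff.2 hψ, ae_all_iff.2 fun j => coeFn_smulConstLp (x j) (ψ j),
      Lp.coeFn_finsetSum (Finset.range (m + 1)) fun j => smulConstLp μ X (x j) (ψ j), hφ]
      with t h1 h2 h3 h4
    rw [h3, Finset.sum_apply, Finset.sum_eq_single_of_mem (σ t)
      (Finset.mem_range.2 (Nat.lt_succ_of_le (hσm t)))]
    · rw [h2, h1, indicator_of_mem (show t ∈ σ ⁻¹' {σ t} from rfl), h4]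
    · intro j _ hj
      rw [h2, h1, indicator_of_notMem, zero_smul]
      exact fun h => hj h.symm
  have hFφ : ‖F‖ ≤ ‖φ‖ := by
    refine Lp.norm_le_norm_of_ae_le ?_
    filter_upwards [hF] with t ht
    rw [ht, norm_smul]
    exact mul_le_of_le_one_right (norm_nonneg _) (hx _)
  have hΛ : Λ F = ‖φ‖ ^ 2 := by
    rw [← real_inner_self_eq_norm_sq]
    simp only [F, map_sum, ← inner_dualDensity]
    conv_rhs => enter [2]; rw [show φ = ∑ j ∈ Finset.range (m + 1), ψ j from rfl]
    rw [inner_sum]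
    refine Finset.sum_congr rfl fun j _ => ?_
    rw [L2.inner_def, L2.inner_def]
    refine integral_congr_ae ?_
    filter_upwards [hψ j, hφ] with t h1 h2
    rw [h1, h2]
    by_cases h : σ t = j
    · rw [h]
    · rw [indicator_of_notMem (show t ∉ σ ⁻¹' {j} from h), inner_zero_right, inner_zero_right]
  have hle : ‖φ‖ ≤ ‖Λ‖ := by
    have h1 : ‖φ‖ ^ 2 ≤ ‖Λ‖ * ‖φ‖ := by
      rw [← hΛ]
      exact (le_abs_self _).trans ((Λ.le_opNorm F).trans (by gcongr))
    by_contra! h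
    have := norm_nonneg Λ
    nlinarith
  have h2 : ∫⁻ t, ‖dualDensity Λ (x (σ t)) t‖ₑ ^ (2 : ℝ) ∂μ = ‖φ‖ₑ ^ (2 : ℝ) := by
    rw [Lp.enorm_def, eLpNorm_eq_lintegral_rpow_enorm_toReal two_ne_zero ENNReal.ofNat_ne_top,
      ← ENNReal.rpow_mul]
    simp only [ENNReal.toReal_ofNat, one_div, inv_mul_cancel₀ (two_ne_zero' ℝ), ENNReal.rpow_one]
    refine lintegral_congr_ae ?_
    filter_upwards [hφ] with t ht
    rw [ht]
  rw [h2]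
  gcongr
  exact enorm_le_iff_norm_le.2 hle

/-- On a countable set the densities are bounded by a square integrable function. -/
theorem exists_memLp_bound_dualDensity (Λ : StrongDual ℝ (Lp X 2 μ)) {D : Set X}
    (hD : D.Countable) :
    ∃ h : Ω → ℝ, MemLp h 2 μ ∧ ∀ᵐ t ∂μ, ∀ x ∈ D, |dualDensity Λ x t| ≤ h t * ‖x‖ := by
  -- Both signs of each normalised vector are listed, so that a one-sided maximum controls absolute
  -- values; adding 0 makes the list nonempty.
  let nrm : ℝ → X → X := fun c x => (c * ‖x‖⁻¹) • x
  obtain ⟨x, hx⟩ := ((((hD.image (nrm 1)).union (hD.image (nrm (-1)))).insert 0)).exists_eq_range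
    ⟨0, mem_insert _ _⟩
  have hn : ∀ c x, |c| ≤ 1 → ‖nrm c x‖ ≤ 1 := by
    intro c x hc
    rw [norm_smul, norm_mul, norm_inv, norm_norm, mul_assoc, Real.norm_eq_abs]
    exact mul_le_one₀ hc (by positivity) inv_mul_le_one
  have hx1 : ∀ j, ‖x j‖ ≤ 1 := by
    intro j
    have : x j ∈ range x := ⟨j, rfl⟩
    rw [← hx] at this
    rcases this with h | ⟨y, -, h⟩ | ⟨y, -, h⟩
    · rw [h]; simp
    · rw [← h]; exact hn _ _ (by simp)
    · rw [← h]; exact hn _ _ (by simp)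
  have hγ : ∀ j, Measurable (dualDensity Λ (x j) : Ω → ℝ) := fun j =>
    (Lp.stronglyMeasurable _).measurable
  obtain ⟨σ, hσ, hσm, hmax⟩ := exists_measurable_argmax hγ
  let S : ℕ → Ω → ℝ≥0∞ := fun m t => ENNReal.ofReal (dualDensity Λ (x (σ m t)) t) ^ (2 : ℝ)
  have hSm : ∀ m, Measurable (S m) := fun m =>
    ((measurable_from_prod_countable_right (f := fun p : ℕ × Ω => dualDensity Λ (x p.1) p.2)
      hγ).comp ((hσ m).prodMk measurable_id)).ennreal_ofReal.pow_const _
  have hmono : Monotone S := by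
    refine monotone_nat_of_le_succ fun m t => ?_
    exact ENNReal.rpow_le_rpow (ENNReal.ofReal_le_ofReal
      (hmax (m + 1) t _ ((hσm m t).trans (Nat.le_succ m)))) (by norm_num)
  have hint : ∫⁻ t, ⨆ m, S m t ∂μ ≤ ‖Λ‖ₑ ^ (2 : ℝ) := by
    rw [lintegral_iSup hSm hmono]
    refine iSup_le fun m => le_trans (lintegral_mono fun t => ?_)
      (lintegral_dualDensity_select_le Λ hx1 (hσ m) (hσm m))
    exact ENNReal.rpow_le_rpow (Real.ofReal_le_enorm _) (by norm_num)
  have hfin : ∫⁻ t, ⨆ m, S m t ∂μ ≠ ∞ :=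
    (hint.trans_lt (ENNReal.rpow_lt_top_of_nonneg (by norm_num) enorm_ne_top)).ne
  have hmeas : Measurable fun t => ⨆ m, S m t := Measurable.iSup hSm
  refine ⟨fun t => ((⨆ m, S m t) ^ (1 / 2 : ℝ)).toReal, ⟨?_, ?_⟩, ?_⟩
  · exact (hmeas.pow_const _).ennreal_toReal.aestronglyMeasurable
  · rw [eLpNorm_lt_top_iff_lintegral_rpow_enorm_lt_top two_ne_zero ENNReal.ofNat_ne_top]
    refine lt_of_le_of_lt (lintegral_mono fun t => ?_) hfin.lt_top
    simp only [ENNReal.toReal_ofNat]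
    calc ‖((⨆ m, S m t) ^ (1 / 2 : ℝ)).toReal‖ₑ ^ (2 : ℝ)
        ≤ ((⨆ m, S m t) ^ (1 / 2 : ℝ)) ^ (2 : ℝ) := by
          gcongr
          rw [Real.enorm_of_nonneg ENNReal.toReal_nonneg]
          exact ENNReal.ofReal_toReal_le
      _ = ⨆ m, S m t := by rw [← ENNReal.rpow_mul]; norm_num
  · have hpt : ∀ᵐ t ∂μ, ∀ y ∈ D, ∀ c : ℤ, |(c : ℝ)| ≤ 1 →
        (c : ℝ) * dualDensity Λ y t = ‖y‖ * dualDensity Λ (nrm c y) t := by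
      rw [ae_ball_iff hD]
      intro y hy
      rw [ae_all_iff]
      intro c
      have e : (c : ℝ) • dualDensity Λ y = ‖y‖ • dualDensity Λ (nrm c y) := by
        rw [← dualDensity_smul, ← dualDensity_smul]
        congr 1
        rcases eq_or_ne y 0 with rfl | h
        · simp
        · rw [smul_smul]
          congr 1
          field_simp [norm_ne_zero_iff.2 h]
      filter_upwards [Lp.coeFn_smul (c : ℝ) (dualDensity Λ y),
        Lp.coeFn_smul ‖y‖ (dualDensity Λ (nrm c y))] with t h1 h2 _
      rw [e, h2] at h1
      exact h1.symm
    filter_upwards [hpt, ae_lt_top hmeas hfin] with t h1 h2 y hy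
    have hb : ∀ j, dualDensity Λ (x j) t ≤ ((⨆ m, S m t) ^ (1 / 2 : ℝ)).toReal := by
      intro j
      refine (ENNReal.ofReal_le_iff_le_toReal ?_).1 ?_
      · exact (ENNReal.rpow_lt_top_of_nonneg (by norm_num) h2.ne).ne
      · rw [one_div, ENNReal.le_rpow_inv_iff (by norm_num)]
        refine le_trans ?_ (le_iSup _ j)
        exact ENNReal.rpow_le_rpow (ENNReal.ofReal_le_ofReal (hmax j t j le_rfl)) (by norm_num)
    have hmem : ∀ c : ℝ, (c = 1 ∨ c = -1) → dualDensity Λ (nrm c y) t ≤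
        ((⨆ m, S m t) ^ (1 / 2 : ℝ)).toReal := by
      intro c hc
      have : nrm c y ∈ range x := by
        rw [← hx]
        rcases hc with rfl | rfl
        · exact Or.inr (Or.inl ⟨y, hy, rfl⟩)
        · exact Or.inr (Or.inr ⟨y, hy, rfl⟩)
      obtain ⟨j, hj⟩ := this
      rw [← hj]
      exact hb j
    have p1 := h1 y hy 1 (by simp)
    have p2 := h1 y hy (-1) (by simp)
    push_cast at p1 p2
    have q1 := mul_le_mul_of_nonneg_left (hmem 1 (Or.inl rfl)) (norm_nonneg y)
    have q2 := mul_le_mul_of_nonneg_left (hmem (-1) (Or.inr rfl)) (norm_nonneg y)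
    rw [abs_le]
    constructor <;> linarith

/-- If the dual of `X` is separable, every continuous linear functional on `L²(μ; X)` is given
by a function in `L²(μ; X*)`. -/
theorem exists_lp_dual_representation [IsFiniteMeasure μ]
    [TopologicalSpace.SeparableSpace (StrongDual ℝ X)] (Λ : StrongDual ℝ (Lp X 2 μ)) :
    ∃ G : Lp (StrongDual ℝ X) 2 μ, ∀ f : Lp X 2 μ, Λ f = ∫ t, G t (f t) ∂μ := by
  have : TopologicalSpace.SeparableSpace X := separableSpace_of_dual
  have : SecondCountableTopology (StrongDual ℝ X) := UniformSpace.secondCountable_of_separable _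
  -- Integer coefficients keep the span countable, so the exceptional null sets for additivity and
  -- for the bound can be united into one.
  let D : Submodule ℤ X := Submodule.span ℤ (range (TopologicalSpace.denseSeq X))
  have hDc : (D : Set X).Countable := countable_coe_iff.1
    (inferInstance : Countable (Submodule.span ℤ (range (TopologicalSpace.denseSeq X))))
  have hD : Dense (D : Set X) :=
    (TopologicalSpace.denseRange_denseSeq X).mono Submodule.subset_span
  obtain ⟨h, hh, hbd⟩ := exists_memLp_bound_dualDensity Λ hDc
  have hadd : ∀ᵐ t ∂μ, ∀ x ∈ (D : Set X), ∀ y ∈ (D : Set X),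
      dualDensity Λ (x + y) t = dualDensity Λ x t + dualDensity Λ y t := by
    rw [ae_ball_iff hDc]
    intro x _
    rw [ae_ball_iff hDc]
    intro y _
    rw [dualDensity_add]
    exact Lp.coeFn_add _ _
  obtain ⟨Z, hZm, hZ0, hZ⟩ : ∃ Z : Set Ω, MeasurableSet Z ∧ μ Z = 0 ∧ ∀ t ∉ Z,
      (∀ x ∈ (D : Set X), |dualDensity Λ x t| ≤ h t * ‖x‖) ∧
      ∀ x ∈ (D : Set X), ∀ y ∈ (D : Set X),
        dualDensity Λ (x + y) t = dualDensity Λ x t + dualDensity Λ y t := by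
    obtain ⟨Z, hsub, hm, h0⟩ := exists_measurable_superset_of_null (hbd.and hadd)
    exact ⟨Z, hm, h0, fun t ht => not_not.1 fun hn => ht (hsub hn)⟩
  have hG : ∀ t, ∃ G : StrongDual ℝ X, ∀ x ∈ D, G x = Zᶜ.indicator (dualDensity Λ x) t := by
    intro t
    by_cases ht : t ∈ Z
    · exact ⟨0, fun x _ => by simp [ht]⟩
    · obtain ⟨G, hG⟩ := exists_dual_extension hD (hZ t ht).2 (hZ t ht).1
      exact ⟨G, fun x hx => by rw [hG x hx, indicator_of_mem ht]⟩
  choose G hG using hG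
  borelize (StrongDual ℝ X)
  have hGm : Measurable G := measurable_of_measurable_apply hDc hD fun x hx => by
    simp only [hG _ x hx]
    exact (Lp.stronglyMeasurable _).measurable.indicator hZm.compl
  have hGh : ∀ᵐ t ∂μ, ‖G t‖ ≤ ‖h t‖ := by
    filter_upwards [measure_eq_zero_iff_ae_notMem.1 hZ0] with t ht
    refine ContinuousLinearMap.opNorm_le_bound _ (norm_nonneg _) fun x => ?_
    have hcl : IsClosed {x : X | ‖G t x‖ ≤ ‖h t‖ * ‖x‖} :=
      isClosed_le (by fun_prop) (by fun_prop)
    refine (hcl.closure_subset_iff.2 (fun x hx => ?_)) (hD x)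
    change ‖G t x‖ ≤ ‖h t‖ * ‖x‖
    rw [hG t x hx, indicator_of_mem ht]
    exact ((hZ t ht).1 x hx).trans (by gcongr; exact le_abs_self _)
  have hGL : MemLp G 2 μ := hh.mono hGm.aestronglyMeasurable hGh
  let Γ : Lp (StrongDual ℝ X) 2 μ := hGL.toLp G
  refine ⟨Γ, fun f => ?_⟩
  let P : StrongDual ℝ (Lp X 2 μ) := (ContinuousLinearMap.id ℝ (StrongDual ℝ X)).lpPairing μ 2 2 Γ
  have hP : ∀ f, P f = ∫ t, Γ t (f t) ∂μ := fun f =>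
    ContinuousLinearMap.lpPairing_eq_integral _ _ _
  rw [← hP]
  have key : ∀ (φ : Lp ℝ 2 μ) (x : X), Λ (smulConstLp μ X x φ) = P (smulConstLp μ X x φ) := by
    intro φ
    have hcl : IsClosed {x : X | Λ (smulConstLp μ X x φ) = P (smulConstLp μ X x φ)} :=
      isClosed_eq (by fun_prop) (by fun_prop)
    intro x
    refine (hcl.closure_subset_iff.2 (fun x hx => ?_)) (hD x)
    change Λ (smulConstLp μ X x φ) = P (smulConstLp μ X x φ)
    rw [hP, ← inner_dualDensity, L2.inner_def]
    refine integral_congr_ae ?_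
    filter_upwards [coeFn_smulConstLp x φ, (hGL.coeFn_toLp : Γ =ᵐ[μ] G),
      measure_eq_zero_iff_ae_notMem.1 hZ0] with t h1 h2 h3
    rw [h1, h2, map_smul, hG t x hx, indicator_of_mem h3]
    simp
  induction f using Lp.induction (p := 2) ENNReal.ofNat_ne_top with
  | indicatorConst c hs hμs =>
    have := key (indicatorConstLp 2 hs hμs.ne 1) c
    have e : smulConstLp μ X c (indicatorConstLp 2 hs hμs.ne 1) = indicatorConstLp 2 hs hμs.ne c := by
      refine Lp.ext ?_
      filter_upwards [coeFn_smulConstLp c (indicatorConstLp 2 hs hμs.ne (1 : ℝ)),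
        indicatorConstLp_coeFn (p := 2) (hs := hs) (hμs := hμs.ne) (c := (1 : ℝ)),
        indicatorConstLp_coeFn (p := 2) (hs := hs) (hμs := hμs.ne) (c := c)] with t h1 h2 h3
      rw [h1, h2, h3]
      simp [indicator]
    rw [e] at this
    exact this
  | add hf hg _ h1 h2 => rw [map_add, map_add, h1, h2]
  | isClosed => exact isClosed_eq Λ.continuous P.continuous

/-- A bounded sequence in `L²(μ; X)` that converges weakly almost everywhere converges weakly. -/
theorem weaklyConverges_of_ae [IsFiniteMeasure μ]
    [TopologicalSpace.SeparableSpace (StrongDual ℝ X)] {f : ℕ → Lp X 2 μ} {f₀ : Lp X 2 μ} {C : ℝ}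
    (hC : ∀ n, ‖f n‖ ≤ C) (hf : ∀ᵐ t ∂μ, WeaklyConverges (fun n => f n t) (f₀ t)) :
    WeaklyConverges f f₀ := by
  rw [weaklyConverges_iff]
  intro Λ
  obtain ⟨G, hG⟩ := exists_lp_dual_representation Λ
  simp only [hG]
  have hint : ∀ f : Lp X 2 μ, Integrable (fun t => G t (f t)) μ := fun f =>
    memLp_one_iff_integrable.1 ((ContinuousLinearMap.id ℝ (StrongDual ℝ X)).memLp_of_bilin 1
      (Lp.memLp G) (Lp.memLp f))
  -- Hölder on `s` makes the pairings uniformly integrable, since only the fixed `G` has to be small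
  -- there; Vitali's theorem then applies.
  have hbound : ∀ (s : Set Ω) (f : Lp X 2 μ), MeasurableSet s →
      eLpNorm (s.indicator fun t => G t (f t)) 1 μ ≤ eLpNorm (s.indicator G) 2 μ * ‖f‖ₑ := by
    intro s f hs
    have := eLpNorm_smul_le_mul_eLpNorm (p := 2) (q := 2) (r := 1) (μ := μ)
      (Lp.aestronglyMeasurable f).norm ((Lp.aestronglyMeasurable G).norm.indicator hs)
    rw [eLpNorm_norm, ← Lp.enorm_def] at this
    refine le_trans (eLpNorm_mono fun t => ?_) (this.trans (le_of_eq ?_))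
    · by_cases ht : t ∈ s
      · simpa [ht] using (G t).le_opNorm (f t)
      · simp [ht]
    · congr 1
      refine eLpNorm_congr_norm_ae (ae_of_all _ fun t => ?_)
      by_cases ht : t ∈ s <;> simp [ht]
  refine tendsto_integral_of_L1' _ (hint f₀).aestronglyMeasurable (Eventually.of_forall fun n => hint (f n)) ?_
  refine tendsto_Lp_finite_of_tendsto_ae le_rfl ENNReal.one_ne_top
    (fun n => (hint (f n)).aestronglyMeasurable) (memLp_one_iff_integrable.2 (hint f₀)) ?_ ?_
  · intro ε hε
    have hC0 : 0 ≤ C := (norm_nonneg _).trans (hC 0)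
    obtain ⟨δ, hδ, hδ'⟩ := (Lp.memLp G).eLpNorm_indicator_le one_le_two ENNReal.ofNat_ne_top
      (ε := ε / (C + 1)) (by positivity)
    refine ⟨δ, hδ, fun n s hs hμs => (hbound s (f n) hs).trans ?_⟩
    calc eLpNorm (s.indicator G) 2 μ * ‖f n‖ₑ
        ≤ ENNReal.ofReal (ε / (C + 1)) * ENNReal.ofReal C := by
          gcongr
          · exact hδ' s hs hμs
          · rw [← ofReal_norm]; exact ENNReal.ofReal_le_ofReal (hC n)
      _ = ENNReal.ofReal (ε / (C + 1) * C) := (ENNReal.ofReal_mul (by positivity)).symm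
      _ ≤ ENNReal.ofReal ε := by
          refine ENNReal.ofReal_le_ofReal ?_
          rw [div_mul_eq_mul_div, div_le_iff₀ (by positivity)]
          nlinarith
  · filter_upwards [hf] with t ht
    exact weaklyConverges_iff.1 ht (G t)

end LpDual

/-! ### Oscillation and quadratic variation -/

section Variation

/-- The choices in different coordinates are independent, so a bound for every joint choice passes
to the sum of the suprema. The constant `c` carries the terms already fixed in the induction. -/
theorem ENNReal.add_sum_iSup_le {ι : Type*} {P : ι → Type*} [∀ k, Nonempty (P k)]
    {F : ∀ k, P k → ℝ≥0∞} {C : ℝ≥0∞} (s : Finset ι) (c : ℝ≥0∞)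
    (h : ∀ p : ∀ k, P k, c + ∑ k ∈ s, F k (p k) ≤ C) : c + ∑ k ∈ s, ⨆ p, F k p ≤ C := by
  classical
  induction s using Finset.induction_on generalizing c with
  | empty => simpa using h fun k => Classical.arbitrary _
  | insert a s ha ih =>
    rw [Finset.sum_insert ha, ← add_assoc, ENNReal.add_iSup, ENNReal.iSup_add]
    refine iSup_le fun q => ih (c + F a q) fun p => ?_
    refine le_trans (le_of_eq ?_) (h (Function.update p a q))
    rw [Finset.sum_insert ha, Function.update_self, add_assoc]
    congr 2
    refine Finset.sum_congr rfl fun k hk => ?_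
    rw [Function.update_of_ne (ne_of_mem_of_not_mem hk ha)]

theorem sum_le_qVariation {Z : Type*} [NormedAddCommGroup Z] {q T δ : ℝ} {K : ℕ} (hK : 0 < K)
    (hδ : K * δ = T) (x : ℝ → Z) {s t : ℕ → ℝ} (h1 : ∀ k, k * δ < s k) (h2 : ∀ k, s k < t k)
    (h3 : ∀ k, t k < (k + 1) * δ) :
    ∑ k ∈ Finset.range K, ‖x (t k) - x (s k)‖ₑ ^ q ≤ qVariation q T x := by
  -- The partition 0 < s₀ < t₀ < s₁ < ⋯ < t_{K-1} < T, with s_k at index 2k + 1 and t_k at 2k + 2;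
  -- only the odd-indexed increments are kept.
  let p : ℕ → ℝ := fun j => if j = 0 then 0 else if j = 2 * K + 1 then T else
    if (j - 1) % 2 = 0 then s ((j - 1) / 2) else t ((j - 1) / 2)
  have p0 : p 0 = 0 := rfl
  have pT : p (2 * K + 1) = T := by simp [p]
  have ps : ∀ k < K, p (2 * k + 1) = s k := by
    intro k hk
    have e1 : 2 * k + 1 ≠ 2 * K + 1 := by omega
    have e2 : (2 * k + 1 - 1) % 2 = 0 := by omega
    have e3 : (2 * k + 1 - 1) / 2 = k := by omega
    simp only [p, e1, e2, e3, if_false, if_true, Nat.succ_ne_zero]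
  have pt : ∀ k < K, p (2 * k + 1 + 1) = t k := by
    intro k hk
    have e1 : 2 * k + 1 + 1 ≠ 2 * K + 1 := by omega
    have e2 : ¬ (2 * k + 1 + 1 - 1) % 2 = 0 := by omega
    have e3 : (2 * k + 1 + 1 - 1) / 2 = k := by omega
    simp only [p, e1, e2, e3, if_false, Nat.succ_ne_zero]
  have hlt : ∀ j < 2 * K + 1, p j < p (j + 1) := by
    intro j hj
    rcases Nat.even_or_odd' j with ⟨k, rfl | rfl⟩
    · rcases k with _ | k
      · rw [ps 0 hK]
        simpa [p0] using h1 0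
      · have e : 2 * (k + 1) = 2 * k + 1 + 1 := by ring
        rw [e, pt k (by omega), ← e]
        rcases eq_or_lt_of_le (show k + 1 ≤ K by omega) with h | h
        · rw [h, pT, ← hδ, ← h]
          exact_mod_cast h3 k
        · rw [ps _ h]
          refine (h3 k).trans ?_
          exact_mod_cast h1 (k + 1)
    · rw [ps k (by omega), pt k (by omega)]
      exact h2 k
  calc ∑ k ∈ Finset.range K, ‖x (t k) - x (s k)‖ₑ ^ q
      = ∑ j ∈ (Finset.range K).image (fun k => 2 * k + 1), ‖x (p (j + 1)) - x (p j)‖ₑ ^ q := by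
        rw [Finset.sum_image (fun a _ b _ h => by simpa using h)]
        refine Finset.sum_congr rfl fun k hk => ?_
        rw [ps k (Finset.mem_range.1 hk), pt k (Finset.mem_range.1 hk)]
    _ ≤ ∑ j ∈ Finset.range (2 * K + 1), ‖x (p (j + 1)) - x (p j)‖ₑ ^ q := by
        refine Finset.sum_le_sum_of_subset fun j hj => ?_
        simp only [Finset.mem_image, Finset.mem_range] at hj ⊢
        omega
    _ ≤ qVariation q T x :=
        le_iSup_of_le (2 * K + 1) (le_iSup_of_le p (le_iSup_of_le p0 (le_iSup_of_le pT
          (le_iSup_of_le hlt le_rfl))))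

/-- The squared oscillations over the intervals of a uniform partition are controlled by the
quadratic variation. -/
theorem exists_oscillation_bound {Z : Type*} [NormedAddCommGroup Z] {T δ : ℝ} {K : ℕ} (hK : 0 < K)
    (hδ0 : 0 < δ) (hδ : K * δ = T) (x : ℝ → Z) :
    ∃ O : ℕ → ℝ≥0∞, ∑ k ∈ Finset.range K, O k ≤ qVariation 2 T x ∧
      ∀ k : ℕ, ∀ s ∈ Ioo (k * δ) ((k + 1) * δ), ∀ t ∈ Ioo (k * δ) ((k + 1) * δ),
        ‖x t - x s‖ₑ ^ (2 : ℝ) ≤ O k := by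
  let P : ℕ → Type := fun k => {p : ℝ × ℝ // k * δ < p.1 ∧ p.1 < p.2 ∧ p.2 < (k + 1) * δ}
  have hne : ∀ k, Nonempty (P k) := by
    intro k
    refine ⟨⟨(k * δ + δ / 3, k * δ + 2 * δ / 3), ?_, ?_, ?_⟩⟩ <;> dsimp only <;> linarith
  refine ⟨fun k => ⨆ p : P k, ‖x p.1.2 - x p.1.1‖ₑ ^ (2 : ℝ), ?_, ?_⟩
  · have := ENNReal.add_sum_iSup_le (P := P) (F := fun k p => ‖x p.1.2 - x p.1.1‖ₑ ^ (2 : ℝ))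
      (C := qVariation 2 T x) (Finset.range K) 0 fun p => by
        rw [zero_add]
        exact sum_le_qVariation hK hδ x (fun k => (p k).2.1) (fun k => (p k).2.2.1)
          (fun k => (p k).2.2.2)
    simpa using this
  · intro k s hs t ht
    rcases lt_trichotomy s t with h | rfl | h
    · exact le_iSup (fun p : P k => ‖x p.1.2 - x p.1.1‖ₑ ^ (2 : ℝ)) ⟨(s, t), hs.1, h, ht.2⟩
    · simp
    · rw [← enorm_neg, neg_sub]
      exact le_iSup (fun p : P k => ‖x p.1.2 - x p.1.1‖ₑ ^ (2 : ℝ)) ⟨(t, s), ht.1, h, hs.2⟩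

end Variation

/-! ### Approximation by interval means -/

section Averages

/-- Integration over a measurable set as an operator on `L²(μ; X)`. -/
def setIntegralLp {Ω : Type*} [MeasurableSpace Ω] (μ : Measure Ω) [IsFiniteMeasure μ]
    (X : Type*) [NormedAddCommGroup X] [NormedSpace ℝ X] [CompleteSpace X] {s : Set Ω}
    (hs : MeasurableSet s) : Lp X 2 μ →L[ℝ] X :=
  (ContinuousLinearMap.lsmul ℝ ℝ).lpPairing μ 2 2 (indicatorConstLp 2 hs (measure_ne_top μ s) 1)

theorem setIntegralLp_apply {Ω : Type*} [MeasurableSpace Ω] {μ : Measure Ω} [IsFiniteMeasure μ]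
    {X : Type*} [NormedAddCommGroup X] [NormedSpace ℝ X] [CompleteSpace X] {s : Set Ω}
    (hs : MeasurableSet s) (u : Lp X 2 μ) : setIntegralLp μ X hs u = ∫ t in s, u t ∂μ := by
  rw [setIntegralLp, ContinuousLinearMap.lpPairing_eq_integral, ← integral_indicator hs]
  refine integral_congr_ae ?_
  filter_upwards [indicatorConstLp_coeFn (p := 2) (hs := hs) (hμs := measure_ne_top μ s)
    (c := (1 : ℝ))] with t ht
  rw [ht]
  by_cases h : t ∈ s <;> simp [h]

variable {X Z : Type*} [NormedAddCommGroup X] [NormedSpace ℝ X] [CompleteSpace X]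
  [NormedAddCommGroup Z] [NormedSpace ℝ Z]

/-- The mean value of `u` over the `k`-th of the intervals of length `δ`. -/
def intervalMean (X : Type*) [NormedAddCommGroup X] [NormedSpace ℝ X] [CompleteSpace X]
    (T δ : ℝ) (k : ℕ) : BochnerLp 2 T X →L[ℝ] X :=
  δ⁻¹ • setIntegralLp (timeMeasure T) X (measurableSet_Ioo (a := k * δ) (b := (k + 1) * δ))

/-- The step function formed by the images of the mean values over a uniform partition. -/
def stepMean (e : X →L[ℝ] Z) (T δ : ℝ) (K : ℕ) (u : BochnerLp 2 T X) : BochnerLp 2 T Z :=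
  ∑ k ∈ Finset.range K, smulConstLp (timeMeasure T) Z (e (intervalMean X T δ k u))
    (indicatorConstLp 2 (measurableSet_Ioo (a := k * δ) (b := (k + 1) * δ))
      (measure_ne_top _ _) 1)

theorem coeFn_stepMean (e : X →L[ℝ] Z) {T δ : ℝ} (hδ : 0 < δ) (K : ℕ) (u : BochnerLp 2 T X) :
    ∀ᵐ t ∂timeMeasure T, ∀ k < K, t ∈ Ioo (k * δ) ((k + 1) * δ) →
      stepMean e T δ K u t = e (intervalMean X T δ k u) := by
  let I : ℕ → Set ℝ := fun k => Ioo (k * δ) ((k + 1) * δ)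
  have hI : ∀ k, MeasurableSet (I k) := fun k => measurableSet_Ioo
  let χ : ℕ → BochnerLp 2 T ℝ := fun k => indicatorConstLp 2 (hI k) (measure_ne_top _ _) 1
  let F : ℕ → BochnerLp 2 T Z := fun k =>
    smulConstLp (timeMeasure T) Z (e (intervalMean X T δ k u)) (χ k)
  have hχ : ∀ k, χ k =ᵐ[timeMeasure T] (I k).indicator fun _ => (1 : ℝ) := fun k =>
    indicatorConstLp_coeFn
  filter_upwards [Lp.coeFn_finsetSum (Finset.range K) F, ae_all_iff.2 hχ,
    ae_all_iff.2 fun k => coeFn_smulConstLp (e (intervalMean X T δ k u)) (χ k)]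
    with t h1 h2 h3 k hk htk
  rw [show stepMean e T δ K u = ∑ k ∈ Finset.range K, F k from rfl, h1, Finset.sum_apply,
    Finset.sum_eq_single_of_mem k (Finset.mem_range.2 hk)]
  · rw [h3, h2, indicator_of_mem (show t ∈ I k from htk), one_smul]
  · intro j _ hj
    rw [h3, h2, indicator_of_notMem, zero_smul]
    intro htj
    refine hj ?_
    have e1 : (j : ℝ) < k + 1 := lt_of_mul_lt_mul_right (htj.1.trans htk.2) hδ.le
    have e2 : (k : ℝ) < j + 1 := lt_of_mul_lt_mul_right (htk.1.trans htj.2) hδ.le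
    have e1' : j < k + 1 := by exact_mod_cast e1
    have e2' : k < j + 1 := by exact_mod_cast e2
    omega

theorem Ioo_subset_Ioo_of_partition {T δ : ℝ} {K : ℕ} (hδ0 : 0 < δ) (hδ : K * δ = T) {k : ℕ}
    (hk : k < K) : Ioo (k * δ) ((k + 1) * δ) ⊆ Ioo 0 T := by
  refine Ioo_subset_Ioo (by positivity) ?_
  rw [← hδ]
  gcongr
  exact_mod_cast hk

theorem lintegral_timeMeasure_le_sum {T δ : ℝ} {K : ℕ} (hδ0 : 0 < δ) (hδ : K * δ = T)
    (F : ℝ → ℝ≥0∞) :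
    ∫⁻ t, F t ∂timeMeasure T ≤
      ∑ k ∈ Finset.range K, ∫⁻ t in Ioo (k * δ) ((k + 1) * δ), F t := by
  have hsub : Ioo 0 T ⊆ ⋃ k : Fin K, Ioc ((k : ℝ) * δ) ((k + 1) * δ) := by
    intro t ht
    have hpos : 0 < t / δ := div_pos ht.1 hδ0
    obtain ⟨k, hk⟩ : ∃ k, ⌈t / δ⌉₊ = k + 1 :=
      Nat.exists_eq_succ_of_ne_zero (Nat.ceil_pos.2 hpos).ne'
    obtain ⟨h1, h2⟩ := (Nat.ceil_eq_iff (Nat.succ_ne_zero k)).1 hk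
    simp only [Nat.succ_eq_add_one, Nat.add_sub_cancel] at h1
    rw [lt_div_iff₀ hδ0] at h1
    rw [div_le_iff₀ hδ0] at h2
    push_cast at h2
    have hkK : (k : ℝ) < K := lt_of_mul_lt_mul_right (h1.trans (hδ ▸ ht.2)) hδ0.le
    exact mem_iUnion.2 ⟨⟨k, by exact_mod_cast hkK⟩, h1, h2⟩
  refine (lintegral_mono_set hsub).trans ((lintegral_iUnion_le _ _).trans ?_)
  rw [tsum_fintype, Finset.sum_range]
  exact Finset.sum_le_sum fun k _ => by rw [setLIntegral_congr Ioo_ae_eq_Ioc]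

/-- Functions of bounded quadratic variation are uniformly approximated by step functions. -/
theorem lintegral_sub_stepMean_le [CompleteSpace Z] (e : X →L[ℝ] Z) {T δ : ℝ} {K : ℕ}
    (hK : 0 < K) (hδ0 : 0 < δ) (hδ : K * δ = T) (u : BochnerLp 2 T X) {x : ℝ → Z}
    (hx : x =ᵐ[timeMeasure T] fun t => e (u t)) (hfin : qVariation 2 T x ≠ ∞) :
    ∫⁻ t, ‖e (u t) - stepMean e T δ K u t‖ₑ ^ (2 : ℝ) ∂timeMeasure T ≤
      ENNReal.ofReal δ * qVariation 2 T x := by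
  obtain ⟨O, hO, hosc⟩ := exists_oscillation_bound hK hδ0 hδ x
  refine (lintegral_timeMeasure_le_sum hδ0 hδ _).trans ?_
  refine le_trans (Finset.sum_le_sum fun k hk => ?_) ((Finset.mul_sum _ _ _).symm.le.trans
    (mul_le_mul_right hO (ENNReal.ofReal δ)))
  have hkK := Finset.mem_range.1 hk
  have hsub := Ioo_subset_Ioo_of_partition hδ0 hδ hkK
  have hOfin : O k ≠ ∞ := ne_top_of_le_ne_top hfin
    ((Finset.single_le_sum (fun _ _ => zero_le) hk).trans hO)
  set I : Set ℝ := Ioo (k * δ) ((k + 1) * δ) with hI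
  have hvol : volume I = ENNReal.ofReal δ := by
    rw [hI, Real.volume_Ioo]; congr 1; ring
  have hrestr : (timeMeasure T).restrict I = volume.restrict I := by
    rw [Measure.restrict_restrict measurableSet_Ioo, inter_eq_left.2 hsub]
  have hxI : ∀ᵐ t ∂volume.restrict I, x t = e (u t) := ae_mono (Measure.restrict_mono_set _ hsub) hx
  have hstep : ∀ᵐ t ∂volume.restrict I, stepMean e T δ K u t = e (intervalMean X T δ k u) := by
    filter_upwards [ae_mono (Measure.restrict_mono_set _ hsub) (coeFn_stepMean e hδ0 K u),
      ae_restrict_mem measurableSet_Ioo] with t h1 h2 using h1 k hkK h2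
  have hint : IntegrableOn u I := by
    have : Integrable u ((timeMeasure T).restrict I) :=
      ((Lp.memLp u).integrable one_le_two).restrict
    rwa [hrestr] at this
  have hmean : e (intervalMean X T δ k u) = ⨍ t in I, e (u t) := by
    rw [intervalMean, smul_apply, setIntegralLp_apply, map_smul, hrestr,
      ← ContinuousLinearMap.integral_comp_comm _ hint, setAverage_eq, Measure.real, hvol,
      ENNReal.toReal_ofReal hδ0.le]
  have hintx : IntegrableOn (fun t => e (u t)) I := e.integrable_comp hint
  have hI0 : volume I ≠ 0 := by rw [hvol]; simpa using hδ0
  have hIt : volume I ≠ ∞ := by rw [hvol]; exact ENNReal.ofReal_ne_top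
  calc ∫⁻ t in I, ‖e (u t) - stepMean e T δ K u t‖ₑ ^ (2 : ℝ)
      ≤ ∫⁻ t in I, O k := by
        refine lintegral_mono_ae ?_
        filter_upwards [hxI, hstep, ae_restrict_mem measurableSet_Ioo] with t h1 h2 ht
        rw [h2, hmean, ← h1]
        -- All values on the interval lie in the closed ball of radius √(O k) about `x t`, and by
        -- convexity so does their mean.
        have hball : ⨍ s in I, e (u s) ∈
            Metric.closedBall (x t) ((O k) ^ (1 / 2 : ℝ)).toReal := by
          refine (convex_closedBall _ _).set_average_mem Metric.isClosed_closedBall hI0 hIt ?_ hintx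
          filter_upwards [hxI, ae_restrict_mem measurableSet_Ioo] with s h1 hs
          rw [← h1, mem_closedBall_iff_norm, norm_sub_rev, ← toReal_enorm]
          refine ENNReal.toReal_mono (ENNReal.rpow_lt_top_of_nonneg (by norm_num) hOfin).ne ?_
          rw [one_div, ENNReal.le_rpow_inv_iff (by norm_num)]
          exact hosc k s hs t ht
        rw [mem_closedBall_iff_norm, norm_sub_rev, ← toReal_enorm] at hball
        have := (ENNReal.toReal_le_toReal enorm_ne_top
          (ENNReal.rpow_lt_top_of_nonneg (by norm_num) hOfin).ne).1 hball
        rwa [one_div, ENNReal.le_rpow_inv_iff (by norm_num)] at this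
    _ = ENNReal.ofReal δ * O k := by rw [setLIntegral_const, hvol, mul_comm]

theorem enorm_compLpL_sub_stepMean_le [CompleteSpace Z] (e : X →L[ℝ] Z) {T δ : ℝ} {K : ℕ}
    (hK : 0 < K) (hδ0 : 0 < δ) (hδ : K * δ = T) (u : BochnerLp 2 T X) {C : ℝ≥0}
    (hu : bvSeminorm e 2 u ≤ C) :
    ‖e.compLpL 2 (timeMeasure T) u - stepMean e T δ K u‖ₑ ^ (2 : ℝ) ≤
      ENNReal.ofReal δ * (C ^ (2 : ℝ) + 1) := by
  -- The infimum need not be attained; the extra 1 leaves room to pick a representative.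
  have hinf : (⨅ (x : ℝ → Z) (_ : x =ᵐ[timeMeasure T] fun t => e (u t)), qVariation 2 T x) <
      (C : ℝ≥0∞) ^ (2 : ℝ) + 1 := by
    rw [bvSeminorm, one_div, ENNReal.rpow_inv_le_iff (by norm_num)] at hu
    refine hu.trans_lt (ENNReal.lt_add_right ?_ one_ne_zero)
    exact (ENNReal.rpow_lt_top_of_nonneg (by norm_num) ENNReal.coe_ne_top).ne
  simp only [iInf_lt_iff] at hinf
  obtain ⟨x, hx, hlt⟩ := hinf
  refine le_trans ?_ ((lintegral_sub_stepMean_le e hK hδ0 hδ u hx hlt.ne_top).trans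
    (mul_le_mul_right hlt.le _))
  rw [Lp.enorm_def, eLpNorm_eq_lintegral_rpow_enorm_toReal two_ne_zero ENNReal.ofNat_ne_top,
      ← ENNReal.rpow_mul]
  simp only [ENNReal.toReal_ofNat, one_div, inv_mul_cancel₀ (two_ne_zero' ℝ), ENNReal.rpow_one]
  refine (lintegral_congr_ae ?_).le
  filter_upwards [Lp.coeFn_sub (e.compLpL 2 (timeMeasure T) u) (stepMean e T δ K u),
    e.coeFn_compLpL u] with t h1 h2
  rw [h1, Pi.sub_apply, h2]

end Averages

/-! ### Compactness in L²(0,T;H) -/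

section Compactness

theorem cauchySeq_of_approx {E : Type*} [NormedAddCommGroup E] {x : ℕ → E}
    (h : ∀ ε > 0, ∃ y : ℕ → E, CauchySeq y ∧ ∀ n, ‖x n - y n‖ ≤ ε) : CauchySeq x := by
  rw [Metric.cauchySeq_iff]
  intro ε hε
  obtain ⟨y, hy, hxy⟩ := h (ε / 4) (by positivity)
  obtain ⟨N, hN⟩ := Metric.cauchySeq_iff.1 hy (ε / 4) (by positivity)
  refine ⟨N, fun m hm n hn => ?_⟩
  have h1 := hN m hm n hn
  have h2 := hxy m
  have h3 := hxy n
  rw [← dist_eq_norm] at h2 h3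
  have := dist_triangle4_right (x m) (x n) (y m) (y n)
  have := dist_triangle (x m) (y m) (x n)
  have := dist_triangle (y m) (y n) (x n)
  rw [dist_comm (y n)] at this
  linarith

variable {V H : Type*} [NormedAddCommGroup V] [NormedSpace ℝ V]
  [NormedAddCommGroup H] [InnerProductSpace ℝ H]

theorem exists_tripleEmbedding_eq_comp (i : V →L[ℝ] H) :
    ∃ E : H →L[ℝ] StrongDual ℝ V, ∀ v, tripleEmbedding i v = E (i v) :=
  ⟨(innerSL ℝ (E := H)).bilinearComp (ContinuousLinearMap.id ℝ H) i, fun _ => rfl⟩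

/-- Interpolation of `L²(0,T;H)` between `L²(0,T;V*)` and `L²(0,T;V)`. -/
theorem exists_norm_compLpL_sq_le (i : V →L[ℝ] H) (T : ℝ) :
    ∃ c : ℝ, 0 ≤ c ∧ ∀ w : BochnerLp 2 T V, ‖i.compLpL 2 (timeMeasure T) w‖ ^ 2 ≤
      c * ‖(tripleEmbedding i).compLpL 2 (timeMeasure T) w‖ * ‖w‖ := by
  let Q := (ContinuousLinearMap.id ℝ (StrongDual ℝ V)).lpPairing (timeMeasure T) 2 2
  refine ⟨‖Q‖, Q.opNorm_nonneg, fun w => ?_⟩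
  refine le_trans (le_of_eq ?_) ((le_abs_self _).trans (Q.le_opNorm₂ _ w))
  rw [← real_inner_self_eq_norm_sq, L2.inner_def, ContinuousLinearMap.lpPairing_eq_integral]
  refine integral_congr_ae ?_
  filter_upwards [i.coeFn_compLpL w, (tripleEmbedding i).coeFn_compLpL w] with t h1 h2
  rw [h1, h2]
  rfl

/-- Compactness of the embedding of `M^{2,2}(0,T;V,V*)` into `L²(0,T;H)`. -/
theorem tendsto_compLpL_of_weaklyConverges [CompleteSpace V] [CompleteSpace H] {i : V →L[ℝ] H}
    (hi : IsEvolutionTriple i) {T : ℝ} (hT : 0 < T) {u : ℕ → BochnerLp 2 T V}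
    {u₀ : BochnerLp 2 T V} {C : ℝ≥0} (hC : ∀ n, mNorm (tripleEmbedding i) 2 (u n) ≤ C)
    (hu : WeaklyConverges u u₀) :
    Tendsto (fun n => i.compLpL 2 (timeMeasure T) (u n)) atTop
      (𝓝 (i.compLpL 2 (timeMeasure T) u₀)) := by
  have hCn : ∀ n, ‖u n‖ ≤ C := fun n => enorm_le_coe.1 (le_self_add.trans (hC n))
  have hCb : ∀ n, bvSeminorm (tripleEmbedding i) 2 (u n) ≤ C := fun n => le_add_self.trans (hC n)
  have hstep : ∀ δ K, CauchySeq fun n => stepMean (tripleEmbedding i) T δ K (u n) := by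
    intro δ K
    have : Tendsto (fun n => stepMean (tripleEmbedding i) T δ K (u n)) atTop
        (𝓝 (stepMean (tripleEmbedding i) T δ K u₀)) := by
      refine tendsto_finsetSum _ fun k _ => ?_
      obtain ⟨E, hE⟩ := exists_tripleEmbedding_eq_comp i
      have h1 := hi.compact.tendsto_of_weaklyConverges (C := ‖intervalMean V T δ k‖ * C)
        (fun n => ((intervalMean V T δ k).le_opNorm (u n)).trans (by gcongr; exact hCn n))
        (hu.map (intervalMean V T δ k))
      have h2 := (E.continuous.tendsto _).comp h1
      simp only [Function.comp_def, ← hE] at h2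
      exact (((smulConstLp (timeMeasure T) (StrongDual ℝ V)).flip _).continuous.tendsto _).comp h2
    exact this.cauchySeq
  have hcau : CauchySeq fun n => (tripleEmbedding i).compLpL 2 (timeMeasure T) (u n) := by
    refine cauchySeq_of_approx fun ε hε => ?_
    -- Chosen so that the squared approximation error (T/K)(C² + 1) is at most ε².
    obtain ⟨K, hK⟩ := exists_nat_gt (T * ((C : ℝ) ^ 2 + 1) / ε ^ 2)
    have hK0 : (0 : ℝ) < K := lt_of_le_of_lt (by positivity) hK
    have hK0' : 0 < K := by exact_mod_cast hK0
    refine ⟨_, hstep (T / K) K, fun n => ?_⟩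
    have h1 := enorm_compLpL_sub_stepMean_le (tripleEmbedding i) hK0' (div_pos hT hK0)
      (by field_simp) (u n) (hCb n)
    have h2 : ENNReal.ofReal (T / K) * ((C : ℝ≥0∞) ^ (2 : ℝ) + 1) ≤
        ENNReal.ofReal ε ^ (2 : ℝ) := by
      have e1 : (C : ℝ≥0∞) ^ (2 : ℝ) + 1 = ENNReal.ofReal ((C : ℝ) ^ 2 + 1) := by
        rw [ENNReal.ofReal_add (by positivity) zero_le_one, ENNReal.ofReal_one,
          ENNReal.ofReal_pow C.coe_nonneg, ENNReal.ofReal_coe_nnreal]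
        norm_num
      rw [e1, ← ENNReal.ofReal_mul (by positivity)]
      have e2 : ENNReal.ofReal ε ^ (2 : ℝ) = ENNReal.ofReal (ε ^ 2) := by
        rw [ENNReal.ofReal_pow hε.le]; norm_num
      rw [e2]
      refine ENNReal.ofReal_le_ofReal ?_
      rw [div_lt_iff₀ (by positivity)] at hK
      rw [div_mul_eq_mul_div, div_le_iff₀ hK0]
      linarith
    have h3 := (ENNReal.rpow_le_rpow_iff (by norm_num)).1 (h1.trans h2)
    rw [← ofReal_norm] at h3
    exact (ENNReal.ofReal_le_ofReal_iff hε.le).1 h3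
  have hcauH : CauchySeq fun n => i.compLpL 2 (timeMeasure T) (u n) := by
    obtain ⟨c, hc, hint⟩ := exists_norm_compLpL_sq_le i T
    rw [Metric.cauchySeq_iff] at hcau ⊢
    intro ε hε
    -- Differences have V-norm at most 2C, so interpolation needs this much; the 1 keeps the
    -- denominator positive.
    obtain ⟨N, hN⟩ := hcau (ε ^ 2 / (c * (2 * C) + 1)) (by positivity)
    refine ⟨N, fun m hm n hn => ?_⟩
    have h1 := hN m hm n hn
    rw [dist_eq_norm, ← map_sub] at h1 ⊢
    have h2 := hint (u m - u n)
    have h3 : ‖u m - u n‖ ≤ 2 * C := (norm_sub_le _ _).trans (by linarith [hCn m, hCn n])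
    rw [lt_div_iff₀ (by positivity)] at h1
    refine lt_of_pow_lt_pow_left₀ 2 hε.le (h2.trans_lt ?_)
    set y := ‖(tripleEmbedding i).compLpL 2 (timeMeasure T) (u m - u n)‖
    have hy : 0 ≤ y := norm_nonneg _
    have h4 : c * y * ‖u m - u n‖ ≤ c * y * (2 * C) := by gcongr
    rcases hy.eq_or_lt with h | h
    · rw [← h]; simp only [mul_zero, zero_mul]; positivity
    · linarith
  obtain ⟨z, hz⟩ := cauchySeq_tendsto_of_complete hcauH
  rwa [(weaklyConverges_of_tendsto hz).unique (hu.map _)] at hz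

end Compactness

/-! ### From integrals to almost every time, and the conclusion -/

theorem exists_subseq_ae_tendsto_of_integral_tendsto_zero {Ω : Type*} [MeasurableSpace Ω]
    {μ : Measure Ω} {f : ℕ → Ω → ℝ} (hf : ∀ n, Integrable (f n) μ) (h0 : ∀ n t, 0 ≤ f n t)
    (h : Tendsto (fun n => ∫ t, f n t ∂μ) atTop (𝓝 0)) :
    ∃ φ : ℕ → ℕ, StrictMono φ ∧ ∀ᵐ t ∂μ, Tendsto (fun n => f (φ n) t) atTop (𝓝 0) := by
  refine (tendstoInMeasure_of_tendsto_eLpNorm (p := 1) (g := fun _ => 0) one_ne_zero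
    (fun n => (hf n).aestronglyMeasurable) aestronglyMeasurable_const ?_).exists_seq_tendsto_ae
  have e : ∀ n, eLpNorm (f n - fun _ => 0) 1 μ = ENNReal.ofReal (∫ t, f n t ∂μ) := by
    intro n
    have : (f n - fun _ => (0 : ℝ)) = f n := by ext t; simp
    rw [this, eLpNorm_one_eq_lintegral_enorm, ← ofReal_integral_norm_eq_lintegral_enorm (hf n)]
    simp only [Real.norm_eq_abs, abs_of_nonneg (h0 n _)]
  simp only [e]
  simpa using ENNReal.tendsto_ofReal h

/-- If a sequence of functions is bounded below by a fixed integrable function, has nonnegative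
lower limits almost everywhere and integrals with nonpositive upper limit, then along a subsequence
its positive parts converge to zero almost everywhere. -/
theorem exists_subseq_ae_tendsto_posPart {Ω : Type*} [MeasurableSpace Ω] {μ : Measure Ω}
    {η : ℕ → Ω → ℝ} {g : Ω → ℝ} (hη : ∀ n, Integrable (η n) μ) (hg : Integrable g μ)
    (hg0 : ∀ t, 0 ≤ g t) (hlow : ∀ n, ∀ᵐ t ∂μ, -g t ≤ η n t)
    (hlim : ∀ᵐ t ∂μ, ∀ ε > 0, ∀ᶠ n in atTop, -ε ≤ η n t)
    (hint : ∀ ε > 0, ∀ᶠ n in atTop, ∫ t, η n t ∂μ ≤ ε) :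
    ∃ φ : ℕ → ℕ, StrictMono φ ∧
      ∀ᵐ t ∂μ, Tendsto (fun n => max (η (φ n) t) 0) atTop (𝓝 0) := by
  have hneg : Tendsto (fun n => ∫ t, max (-η n t) 0 ∂μ) atTop (𝓝 0) := by
    rw [show 𝓝 (0 : ℝ) = 𝓝 (∫ _, (0 : ℝ) ∂μ) by rw [integral_zero]]
    refine tendsto_integral_of_dominated_convergence g
      (fun n => (hη n).neg_part.aestronglyMeasurable) hg (fun n => ?_) ?_
    · filter_upwards [hlow n] with t ht
      rw [Real.norm_of_nonneg (le_max_right _ _)]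
      exact max_le (by linarith) (hg0 t)
    · filter_upwards [hlim] with t ht
      rw [Metric.tendsto_nhds]
      intro ε hε
      filter_upwards [ht (ε / 2) (by positivity)] with n hn
      rw [Real.dist_eq, sub_zero, abs_of_nonneg (le_max_right _ _)]
      exact max_lt (by linarith) hε
  refine exists_subseq_ae_tendsto_of_integral_tendsto_zero (f := fun n t => max (η n t) 0)
    (fun n => (hη n).pos_part) (fun n t => le_max_right _ _) ?_
  have hsum : ∀ n, ∫ t, max (η n t) 0 ∂μ = ∫ t, η n t ∂μ + ∫ t, max (-η n t) 0 ∂μ := by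
    intro n
    rw [← integral_add (hη n) (hη n).neg_part]
    refine integral_congr_ae (ae_of_all _ fun t => ?_)
    dsimp only
    rcases le_total (η n t) 0 with h | h
    · rw [max_eq_right h, max_eq_left (by linarith)]; ring
    · rw [max_eq_left h, max_eq_right (by linarith)]; ring
  rw [Metric.tendsto_nhds]
  intro ε hε
  filter_upwards [hint (ε / 3) (by positivity),
    hneg.eventually_lt_const (show (0 : ℝ) < ε / 3 by positivity)] with n h1 h2
  rw [Real.dist_eq, sub_zero, abs_of_nonneg (integral_nonneg fun t => le_max_right _ _), hsum]
  linarith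

section Main

variable {V H : Type*} [NormedAddCommGroup V] [NormedSpace ℝ V]
  [NormedAddCommGroup H] [InnerProductSpace ℝ H]

theorem integrable_apply {T : ℝ} (ξ : BochnerLp 2 T (StrongDual ℝ V)) (v : BochnerLp 2 T V) :
    Integrable (fun t => ξ t (v t)) (timeMeasure T) :=
  memLp_one_iff_integrable.1 ((ContinuousLinearMap.id ℝ (StrongDual ℝ V)).memLp_of_bilin 1
    (Lp.memLp ξ) (Lp.memLp v))

theorem HypA.exists_norm_nemytskii_le [TopologicalSpace.SeparableSpace V] {i : V →L[ℝ] H}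
    (hi : IsEvolutionTriple i) {A : V → StrongDual ℝ V} (hA : HypA i A) (T C : ℝ) :
    ∃ C' : ℝ, ∀ u : BochnerLp 2 T V, ‖u‖ ≤ C → ‖hA.nemytskii hi u‖ ≤ C' := by
  obtain ⟨a, b, ha, hb, hab⟩ := hA.growth
  let c : BochnerLp 2 T ℝ := (memLp_const a).toLp fun _ => a
  refine ⟨‖c‖ + b * C, fun u hu => ?_⟩
  let d : BochnerLp 2 T ℝ := (Lp.memLp u).norm.toLp fun t => ‖u t‖
  have hd : ‖d‖ = ‖u‖ := by
    rw [Lp.norm_toLp, eLpNorm_norm, Lp.norm_def]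
  have h1 : ‖hA.nemytskii hi u‖ ≤ ‖c + b • d‖ := by
    refine Lp.norm_le_norm_of_ae_le ?_
    filter_upwards [hA.isNemytskii hi T u, Lp.coeFn_add c (b • d), Lp.coeFn_smul b d,
      ((memLp_const a).coeFn_toLp : c =ᵐ[timeMeasure T] fun _ => a),
      ((Lp.memLp u).norm.coeFn_toLp : d =ᵐ[timeMeasure T] fun t => ‖u t‖)] with t e1 e2 e3 e4 e5
    rw [e1, e2, Pi.add_apply, e3, Pi.smul_apply, e4, e5, smul_eq_mul]
    exact (hab _).trans (le_abs_self _)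
  refine h1.trans ((norm_add_le _ _).trans ?_)
  rw [norm_smul, Real.norm_of_nonneg hb.le, hd]
  gcongr

/-- Almost everywhere weak convergence of the values of the Nemytskii operator along a
subsequence. -/
theorem HypA.exists_subseq_ae_weaklyConverges [TopologicalSpace.SeparableSpace V]
    [CompleteSpace H] {i : V →L[ℝ] H} (hi : IsEvolutionTriple i)
    {A : V → StrongDual ℝ V} (hA : HypA i A) {T : ℝ} {u : ℕ → BochnerLp 2 T V}
    {u₀ : BochnerLp 2 T V}
    (hu : Tendsto (fun n => i.compLpL 2 (timeMeasure T) (u n)) atTop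
      (𝓝 (i.compLpL 2 (timeMeasure T) u₀)))
    (hlim : ∀ ε > 0, ∀ᶠ n in atTop, pairing (hA.nemytskii hi (u n)) (u n - u₀) ≤ ε) :
    ∃ φ : ℕ → ℕ, StrictMono φ ∧ ∀ᵐ t ∂timeMeasure T,
      WeaklyConverges (fun n => hA.nemytskii hi (u (φ n)) t) (hA.nemytskii hi u₀ t) := by
  obtain ⟨α, β, c, hα, hβ, hc, hlow⟩ := hA.exists_lower_bound
  obtain ⟨φ₁, hφ₁, hae₁⟩ := (tendstoInMeasure_of_tendsto_Lp hu).exists_seq_tendsto_ae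
  let w : ℕ → BochnerLp 2 T V := fun n => u (φ₁ n)
  have hi_ae : ∀ v : BochnerLp 2 T V, ∀ᵐ t ∂timeMeasure T,
      i.compLpL 2 (timeMeasure T) v t = i (v t) := fun v => i.coeFn_compLpL v
  have hiw : ∀ᵐ t ∂timeMeasure T, Tendsto (fun n => i (w n t)) atTop (𝓝 (i (u₀ t))) := by
    filter_upwards [hae₁, ae_all_iff.2 fun n => hi_ae (w n), hi_ae u₀] with t h1 h2 h3
    simpa only [w, h3, ← h2] using h1
  let r : ℕ → BochnerLp 2 T H := fun n => i.compLpL 2 (timeMeasure T) (w n - u₀)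
  have hr : Tendsto (fun n => ‖r n‖ ^ 2) atTop (𝓝 0) := by
    have := (tendsto_iff_norm_sub_tendsto_zero.1 (hu.comp hφ₁.tendsto_atTop)).pow 2
    simpa only [r, w, map_sub, Function.comp_apply, ne_eq, OfNat.ofNat_ne_zero,
      not_false_eq_true, zero_pow] using this
  -- Adding the H-term makes the lower bound `-g` independent of n. It is harmless: it is
  -- nonnegative and its integral tends to 0.
  let η : ℕ → ℝ → ℝ := fun n t =>
    hA.nemytskii hi (w n) t ((w n - u₀) t) + β * ‖r n t‖ ^ 2
  let g : ℝ → ℝ := fun t => c * (1 + ‖u₀ t‖ ^ 2)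
  have hg0 : ∀ t, 0 ≤ g t := fun t => by positivity
  have hrint : ∀ n, Integrable (fun t => ‖r n t‖ ^ 2) (timeMeasure T) := fun n =>
    (Lp.memLp (r n)).integrable_norm_pow two_ne_zero
  have hηint : ∀ n, Integrable (η n) (timeMeasure T) := fun n =>
    (integrable_apply _ _).add ((hrint n).const_mul β)
  have hgint : Integrable g (timeMeasure T) :=
    ((integrable_const 1).add ((Lp.memLp u₀).integrable_norm_pow two_ne_zero)).const_mul c
  have hη : ∀ᵐ t ∂timeMeasure T, ∀ n,
      η n t = A (w n t) (w n t - u₀ t) + β * ‖i (w n t - u₀ t)‖ ^ 2 := by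
    rw [ae_all_iff]
    intro n
    filter_upwards [hA.isNemytskii hi T (w n), Lp.coeFn_sub (w n) u₀, hi_ae (w n - u₀)]
      with t h1 h2 h3
    simp only [η, r, h1, h3, h2, Pi.sub_apply]
  have hcoer : ∀ᵐ t ∂timeMeasure T, ∀ n, α * ‖w n t‖ ^ 2 - g t ≤ η n t := by
    filter_upwards [hη] with t ht n
    rw [ht]
    linarith [hlow (w n t) (u₀ t)]
  have hηlim : ∀ᵐ t ∂timeMeasure T, ∀ ε > 0, ∀ᶠ n in atTop, -ε ≤ η n t := by
    filter_upwards [hη, hiw] with t h1 h2 ε hε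
    filter_upwards [hA.eventually_neg_le hi h2 hε] with n hn
    rw [h1]
    have : 0 ≤ β * ‖i (w n t - u₀ t)‖ ^ 2 := by positivity
    linarith
  have hηI : ∀ n, ∫ t, η n t ∂timeMeasure T =
      pairing (hA.nemytskii hi (w n)) (w n - u₀) + β * ‖r n‖ ^ 2 := by
    intro n
    rw [integral_add (integrable_apply _ _) ((hrint n).const_mul β), integral_const_mul,
      ← real_inner_self_eq_norm_sq (r n), L2.inner_def]
    simp only [real_inner_self_eq_norm_sq]
    rfl
  obtain ⟨φ₂, hφ₂, hae₂⟩ := exists_subseq_ae_tendsto_posPart hηint hgint hg0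
    (fun n => by
      filter_upwards [hcoer] with t ht
      have : 0 ≤ α * ‖w n t‖ ^ 2 := by positivity
      linarith [ht n]) hηlim (fun ε hε => by
      have h1 : Tendsto (fun n => β * ‖r n‖ ^ 2) atTop (𝓝 0) := by
        simpa using hr.const_mul β
      filter_upwards [hφ₁.tendsto_atTop.eventually (hlim (ε / 2) (by positivity)),
        h1.eventually_lt_const (show (0 : ℝ) < ε / 2 by positivity)] with n h2 h3
      rw [hηI]
      linarith)
  refine ⟨φ₁ ∘ φ₂, hφ₁.comp hφ₂, ?_⟩
  filter_upwards [hae₂, hη, hcoer, hiw, hA.isNemytskii hi T u₀,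
    ae_all_iff.2 fun n => hA.isNemytskii hi T (w n)] with t h1 h2 h3 h4 h5 h6
  -- For fixed t, convergent positive parts bound `η` above, and coercivity turns this into a bound
  -- on the values in V.
  obtain ⟨M, hM⟩ := h1.bddAbove_range
  have hbd : ∀ n, ‖w (φ₂ n) t‖ ≤ (M + g t) / α + 1 := by
    intro n
    have e1 : η (φ₂ n) t ≤ M := (le_max_left _ _).trans (hM ⟨n, rfl⟩)
    have e2 : ‖w (φ₂ n) t‖ ^ 2 ≤ (M + g t) / α := by
      rw [le_div_iff₀ hα]
      linarith [h3 (φ₂ n)]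
    nlinarith [sq_nonneg (‖w (φ₂ n) t‖ - 1)]
  have hweak : WeaklyConverges (fun n => w (φ₂ n) t) (u₀ t) :=
    weaklyConverges_of_bounded hi hbd (h4.comp hφ₂.tendsto_atTop)
  have hA_lim : ∀ ε > 0, ∀ᶠ n in atTop, A (w (φ₂ n) t) (w (φ₂ n) t - u₀ t) ≤ ε := by
    intro ε hε
    filter_upwards [h1.eventually_lt_const hε] with n hn
    have e1 : η (φ₂ n) t < ε := (le_max_left _ _).trans_lt hn
    rw [h2] at e1
    have : 0 ≤ β * ‖i (w (φ₂ n) t - u₀ t)‖ ^ 2 := by positivity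
    linarith
  rw [weaklyConverges_iff]
  intro Φ
  obtain ⟨z, rfl⟩ := hi.reflexive Φ
  simp only [NormedSpace.dual_def, Function.comp_apply, h5]
  have := hA.pseudomonotone.tendsto_apply hweak hA_lim z
  simpa only [w, ← h6] using this

end Main

end

theorem mainTheorem5 {V H : Type*}
    [NormedAddCommGroup V] [NormedSpace ℝ V] [CompleteSpace V] [TopologicalSpace.SeparableSpace V]
    [NormedAddCommGroup H] [InnerProductSpace ℝ H] [CompleteSpace H]
    [TopologicalSpace.SeparableSpace H]
    (i : V →L[ℝ] H) (hi : IsEvolutionTriple i) (T : ℝ) (hT : 0 < T)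
    (A : V → StrongDual ℝ V) (hA : HypA i A) :
    ∃ N : BochnerLp 2 T V → BochnerLp 2 T (StrongDual ℝ V), IsNemytskii A N ∧
      ∀ (u : ℕ → BochnerLp 2 T V) (u₀ : BochnerLp 2 T V),
        (∀ n, u n ∈ MSpace (tripleEmbedding i) 2 2 T) →
        (∃ C : ℝ≥0, ∀ n, mNorm (tripleEmbedding i) 2 (u n) ≤ C) →
        WeaklyConverges u u₀ →
        limsup (fun n => ((pairing (N (u n)) (u n - u₀) : ℝ) : EReal)) atTop ≤ 0 →
        WeaklyConverges (fun n => N (u n)) (N u₀) := by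
  refine ⟨hA.nemytskii hi, hA.isNemytskii hi T, fun u u₀ _ ⟨C, hC⟩ hu hlim => ?_⟩
  have hsep := separableSpace_dual_of_reflexive hi.reflexive
  -- The representation of functionals is used with X = V*, so the bidual must be separable; by
  -- reflexivity it is an image of V.
  have : TopologicalSpace.SeparableSpace (StrongDual ℝ (StrongDual ℝ V)) :=
    hi.reflexive.denseRange.separableSpace (NormedSpace.inclusionInDoubleDual ℝ V).continuous
  have hcpt := tendsto_compLpL_of_weaklyConverges hi hT hC hu
  obtain ⟨C', hC'⟩ := hA.exists_norm_nemytskii_le hi T C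
  rw [weaklyConverges_iff]
  intro Λ
  refine tendsto_of_subseq_tendsto fun ns hns => ?_
  obtain ⟨φ, -, hae⟩ := hA.exists_subseq_ae_weaklyConverges hi (hcpt.comp hns) fun ε hε =>
    hns.eventually ((eventually_lt_of_limsup_coe_le (a := 0) hlim hε).mono fun n hn => hn.le)
  exact ⟨φ, weaklyConverges_iff.1 (weaklyConverges_of_ae
    (fun n => hC' _ (enorm_le_coe.1 (le_self_add.trans (hC _)))) hae) Λ⟩
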